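/- Let $X$ be a non-empty compact Hausdorff space that is a finite set, let $\sigma:X\to X$ be a homeomorphism, and let $\Sigma=(X,\sigma)$. Let $\alpha(f)=f\circ\sigma^{-1}$ for $f\in C(X)$, and let $\ell^1(\Sigma)$ be the unital Banach $*$-algebra of all $a:\mathbb Z\to C(X)$ with $\|a\|=\sum_{n}\|a(n)\|_\infty<\infty$, with multiplication $(ab)(n)=\sum_{k\in\mathbb Z}a(k)\,\alpha^k(b(n-k))$ and involution $a^*(n)=\overline{\alpha^n(a(-n))}$. Write $a=\sum_n f_n\delta^n$ with $f_n=a(n)$. A representation of $\ell^1(\Sigma)$ on a complex vector space $E$ is a (not necessarily unital) algebra homomorphism $\pi$ into the linear operators on $E$. It is algebraically irreducible if $\pi(\ell^1(\Sigma))E\neq\{0\}$ and $\{0\}$ and $E$ are its only invariant subspaces. Two representations are algebraically equivalent if there is a linear bijection intertwining them. A primitive ideal is the kernel of an algebraically irreducible representation. For $x\in X$ with period $p$ and $\lambda\in\mathbb T=\{\lambda\in\mathbb C:|\lambda|=1\}$, let $\pi_{x,\lambda}$ be the $*$-representation of $\ell^1(\Sigma)$ on the Hilbert space with orthonormal basis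 $e_0,\dots,e_{p-1}$ given by $\pi_{x,\lambda}\big(\sum_n f_n\delta^n\big)=\sum_n\rho_x(f_n)T_\lambda^n$, where $\rho_x(f)e_j=f(\sigma^j x)e_j$, $T_\lambda e_j=e_{j+1}$ for $0\le j<p-1$, and $T_\lambda e_{p-1}=\lambda e_0$. Then: 1. Every algebraically irreducible representation of $\ell^1(\Sigma)$ on a complex vector space is finite dimensional. 2. Every $\pi_{x,\lambda}$ is algebraically irreducible. Its algebraic equivalence class depends only on $\lambda$ and the orbit of $x$, and assigning to $(\mathfrak o,\lambda)$ the class of $\pi_{x,\lambda}$, where $x\in\mathfrak o$, is a bijection from $(X/\mathbb Z)\times\mathbb T$ onto the collection of algebraic equivalence classes of algebraically irreducible representations of $\ell^1(\Sigma)$. Here $X/\mathbb Z$ is the set of orbits of $\sigma$. 3. The space of every algebraically irreducible representation of $\ell^1(\Sigma)$ can be given a Hilbert space structure for which the representation is a $*$-representation. 4. Every primitive ideal of $\ell^1(\Sigma)$ is selfadjoint. -/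

import Mathlib

universe u v

set_option linter.unusedSectionVars false

noncomputable section

namespace DynSys

variable {X : Type u} [TopologicalSpace X]

/-- The `n`-th power of the automorphism `α(f) = f ∘ σ⁻¹` of `C(X)`, that is, `f ↦ f ∘ σ⁻ⁿ`. -/
def alpha (σ : X ≃ₜ X) (n : ℤ) : C(X, ℂ) →⋆ₐ[ℂ] C(X, ℂ) :=
  ContinuousMap.compStarAlgHom' ℂ ℂ ⟨((σ ^ (-n) : X ≃ₜ X) : X → X), (σ ^ (-n)).continuous⟩

theorem alpha_apply (σ : X ≃ₜ X) (n : ℤ) (f : C(X, ℂ)) (x : X) :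
    alpha σ n f x = f ((σ ^ (-n) : X ≃ₜ X) x) := rfl

theorem alpha_zero (σ : X ≃ₜ X) (f : C(X, ℂ)) : alpha σ 0 f = f := by
  ext x
  simp [alpha_apply]

theorem alpha_alpha (σ : X ≃ₜ X) (m n : ℤ) (f : C(X, ℂ)) :
    alpha σ m (alpha σ n f) = alpha σ (m + n) f := by
  ext x
  have h : -(m + n) = -n + -m := by ring
  rw [alpha_apply, alpha_apply, alpha_apply, h, zpow_add]
  rfl

variable [CompactSpace X]

theorem norm_alpha_le (σ : X ≃ₜ X) (n : ℤ) (f : C(X, ℂ)) : ‖alpha σ n f‖ ≤ ‖f‖ := by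
  rw [ContinuousMap.norm_le _ (norm_nonneg _)]
  intro x
  exact f.norm_coe_le_norm _

theorem continuous_alpha (σ : X ≃ₜ X) (n : ℤ) : Continuous (alpha σ n) :=
  AddMonoidHomClass.continuous_of_bound (alpha σ n) 1
    (fun f => by simpa using norm_alpha_le σ n f)

/-- The Banach space underlying the Banach algebra `ℓ¹(Σ)` of the dynamical system `Σ = (X, σ)`:
all `a : ℤ → C(X)` with `∑ ‖a n‖ < ∞`, normed by that sum. -/
def Ell1 (_σ : X ≃ₜ X) : Type u := lp (fun _ : ℤ => C(X, ℂ)) 1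

namespace Ell1

variable {σ : X ≃ₜ X}

instance : NormedAddCommGroup (Ell1 σ) :=
  inferInstanceAs (NormedAddCommGroup (lp (fun _ : ℤ => C(X, ℂ)) 1))

instance : NormedSpace ℂ (Ell1 σ) :=
  inferInstanceAs (NormedSpace ℂ (lp (fun _ : ℤ => C(X, ℂ)) 1))

instance : CompleteSpace (Ell1 σ) :=
  inferInstanceAs (CompleteSpace (lp (fun _ : ℤ => C(X, ℂ)) 1))

/-- An element of `ℓ¹(Σ)`, viewed in Mathlib's space of summable families. -/
def toLp (a : Ell1 σ) : lp (fun _ : ℤ => C(X, ℂ)) 1 := a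

instance : FunLike (Ell1 σ) ℤ C(X, ℂ) where
  coe a := a.toLp.1
  coe_injective _ _ h := Subtype.ext h

theorem ext {a b : Ell1 σ} (h : ∀ n, a n = b n) : a = b := DFunLike.ext _ _ h

theorem memlp_one {f : ℤ → C(X, ℂ)} :
    Memℓp f 1 ↔ Summable (fun n => ‖f n‖) := by
  rw [memℓp_gen_iff (by simp)]
  simp

/-- The element of `ℓ¹(Σ)` given by an absolutely summable sequence. -/
def mk (f : ℤ → C(X, ℂ)) (hf : Summable (fun n => ‖f n‖)) : Ell1 σ := ⟨f, memlp_one.2 hf⟩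

theorem mk_apply (f : ℤ → C(X, ℂ)) (hf : Summable (fun n => ‖f n‖)) (n : ℤ) :
    (mk f hf : Ell1 σ) n = f n := rfl

theorem summable_norm (a : Ell1 σ) : Summable (fun n => ‖a n‖) := memlp_one.1 a.2

theorem norm_def (a : Ell1 σ) : ‖a‖ = ∑' n, ‖a n‖ := by
  have h := lp.norm_eq_tsum_rpow (p := 1) (by simp) a.toLp
  simp only [ENNReal.toReal_one, Real.rpow_one, div_one] at h
  exact h

theorem add_apply (a b : Ell1 σ) (n : ℤ) : (a + b) n = a n + b n := rfl

theorem smul_apply (c : ℂ) (a : Ell1 σ) (n : ℤ) : (c • a) n = c • a n := rfl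

theorem zero_apply (n : ℤ) : (0 : Ell1 σ) n = 0 := rfl

theorem summable_pair (a b : Ell1 σ) :
    Summable (fun p : ℤ × ℤ => ‖a p.1 * alpha σ p.1 (b p.2)‖) := by
  refine Summable.of_nonneg_of_le (fun _ => norm_nonneg _) (fun p => ?_)
    (a.summable_norm.mul_of_nonneg b.summable_norm (fun _ => norm_nonneg _)
      (fun _ => norm_nonneg _))
  exact (norm_mul_le _ _).trans
    (mul_le_mul_of_nonneg_left (norm_alpha_le σ _ _) (norm_nonneg _))

/-- The bijection `(n, k) ↦ (k, n - k)` of `ℤ × ℤ`. -/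
def convEquiv : ℤ × ℤ ≃ ℤ × ℤ where
  toFun p := (p.2, p.1 - p.2)
  invFun p := (p.1 + p.2, p.1)
  left_inv p := by ext <;> simp
  right_inv p := by ext <;> simp

theorem summable_conv (a b : Ell1 σ) :
    Summable (fun p : ℤ × ℤ => ‖a p.2 * alpha σ p.2 (b (p.1 - p.2))‖) :=
  (convEquiv.summable_iff).2 (summable_pair a b)

theorem summable_conv_right (a b : Ell1 σ) (n : ℤ) :
    Summable (fun k : ℤ => ‖a k * alpha σ k (b (n - k))‖) :=
  (summable_conv a b).prod_factor n

theorem summable_mul (a b : Ell1 σ) :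
    Summable (fun n : ℤ => ‖∑' k : ℤ, a k * alpha σ k (b (n - k))‖) :=
  Summable.of_nonneg_of_le (fun _ => norm_nonneg _)
    (fun n => norm_tsum_le_tsum_norm (summable_conv_right a b n)) (summable_conv a b).prod

/-- Twisted convolution. -/
instance : Mul (Ell1 σ) where
  mul a b := mk (fun n => ∑' k : ℤ, a k * alpha σ k (b (n - k))) (summable_mul a b)

theorem mul_apply (a b : Ell1 σ) (n : ℤ) :
    (a * b) n = ∑' k : ℤ, a k * alpha σ k (b (n - k)) := rfl

theorem summable_single (m : ℤ) (f : C(X, ℂ)) :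
    Summable (fun n : ℤ => ‖(if n = m then f else 0 : C(X, ℂ))‖) :=
  summable_of_ne_finset_zero (s := {m}) (fun n hn => by simp_all)

/-- The element `f δᵐ` of `ℓ¹(Σ)`. -/
def single (m : ℤ) (f : C(X, ℂ)) : Ell1 σ :=
  mk (fun n => if n = m then f else 0) (summable_single m f)

theorem single_apply (m : ℤ) (f : C(X, ℂ)) (n : ℤ) :
    (single m f : Ell1 σ) n = if n = m then f else 0 := rfl

instance : One (Ell1 σ) := ⟨single 0 1⟩

theorem one_apply (n : ℤ) : (1 : Ell1 σ) n = if n = 0 then 1 else 0 := rfl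

theorem star_summable (a : Ell1 σ) : Summable (fun n : ℤ => ‖star (alpha σ n (a (-n)))‖) := by
  refine Summable.of_nonneg_of_le (fun _ => norm_nonneg _) (fun n => ?_)
    ((Equiv.neg ℤ).summable_iff.2 a.summable_norm)
  rw [norm_star]
  exact norm_alpha_le σ _ _

instance : Star (Ell1 σ) where
  star a := mk (fun n => star (alpha σ n (a (-n)))) (star_summable a)

theorem star_apply (a : Ell1 σ) (n : ℤ) : (star a) n = star (alpha σ n (a (-n))) := rfl

theorem summable_term (a b : Ell1 σ) (n : ℤ) :
    Summable (fun k : ℤ => a k * alpha σ k (b (n - k))) :=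
  (summable_conv_right a b n).of_norm

protected theorem mul_add (a b c : Ell1 σ) : a * (b + c) = a * b + a * c := by
  refine ext fun n => ?_
  rw [add_apply, mul_apply, mul_apply, mul_apply,
    ← (summable_term a b n).tsum_add (summable_term a c n)]
  exact tsum_congr fun k => by rw [add_apply, map_add, mul_add]

protected theorem add_mul (a b c : Ell1 σ) : (a + b) * c = a * c + b * c := by
  refine ext fun n => ?_
  rw [add_apply, mul_apply, mul_apply, mul_apply,
    ← (summable_term a c n).tsum_add (summable_term b c n)]
  exact tsum_congr fun k => by rw [add_apply, add_mul]

protected theorem one_mul (a : Ell1 σ) : 1 * a = a := by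
  refine ext fun n => ?_
  rw [mul_apply, tsum_eq_single 0 (fun k hk => by simp [one_apply, hk])]
  simp [one_apply, alpha_zero, sub_zero]

protected theorem mul_one (a : Ell1 σ) : a * 1 = a := by
  refine ext fun n => ?_
  rw [mul_apply, tsum_eq_single n (fun k hk => by
    have : n - k ≠ 0 := sub_ne_zero.2 (Ne.symm hk)
    simp [one_apply, this])]
  simp [one_apply]

theorem summable_triple (a b c : Ell1 σ) (n : ℤ) :
    Summable (fun p : ℤ × ℤ =>
      a p.2 * alpha σ p.2 (b (p.1 - p.2)) * alpha σ p.1 (c (n - p.1))) := by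
  refine Summable.of_norm_bounded ((summable_conv a b).mul_right ‖c‖) (fun p => ?_)
  refine (norm_mul_le _ _).trans (mul_le_mul_of_nonneg_left ?_ (norm_nonneg _))
  refine (norm_alpha_le σ _ _).trans ?_
  rw [norm_def]
  exact c.summable_norm.le_tsum _ (fun _ _ => norm_nonneg _)

protected theorem mul_assoc (a b c : Ell1 σ) : a * b * c = a * (b * c) := by
  refine ext fun n => ?_
  rw [mul_apply, mul_apply]
  have h1 : ∀ k : ℤ, (a * b) k * alpha σ k (c (n - k))
      = ∑' j : ℤ, a j * alpha σ j (b (k - j)) * alpha σ k (c (n - k)) := fun k => by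
    rw [mul_apply, (summable_term a b k).tsum_mul_right]
  have h2 : ∀ j : ℤ, a j * alpha σ j ((b * c) (n - j))
      = ∑' k : ℤ, a j * alpha σ j (b (k - j)) * alpha σ k (c (n - k)) := fun j => by
    have hs : Summable (fun m : ℤ => alpha σ j (b m * alpha σ m (c (n - j - m)))) :=
      (summable_term b c (n - j)).map (alpha σ j) (continuous_alpha σ j)
    rw [mul_apply, (summable_term b c (n - j)).map_tsum (alpha σ j) (continuous_alpha σ j),
      ← hs.tsum_mul_left, ← (Equiv.subRight j).tsum_eq]
    refine tsum_congr fun k => ?_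
    have e1 : n - j - (k - j) = n - k := by ring
    have e2 : j + (k - j) = k := by ring
    simp only [Equiv.subRight_apply, map_mul, alpha_alpha, e1, e2, _root_.mul_assoc]
  rw [tsum_congr h1, tsum_congr h2]
  exact (summable_triple a b c n).tsum_comm.symm

instance : Ring (Ell1 σ) :=
  { (inferInstance : AddCommGroup (Ell1 σ)), (inferInstance : Mul (Ell1 σ)),
    (inferInstance : One (Ell1 σ)) with
    left_distrib := Ell1.mul_add
    right_distrib := Ell1.add_mul
    zero_mul := fun a => by
      refine ext fun n => ?_
      have h : ∀ k : ℤ, (0 : Ell1 σ) k * alpha σ k (a (n - k)) = 0 := fun k => by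
        rw [zero_apply, zero_mul]
      rw [mul_apply, tsum_congr h, tsum_zero, zero_apply]
    mul_zero := fun a => by
      refine ext fun n => ?_
      have h : ∀ k : ℤ, a k * alpha σ k ((0 : Ell1 σ) (n - k)) = 0 := fun k => by
        rw [zero_apply, map_zero, mul_zero]
      rw [mul_apply, tsum_congr h, tsum_zero, zero_apply]
    mul_assoc := Ell1.mul_assoc
    one_mul := Ell1.one_mul
    mul_one := Ell1.mul_one }

instance : Algebra ℂ (Ell1 σ) :=
  Algebra.ofModule
    (fun c a b => ext fun n => by
      rw [smul_apply, mul_apply, mul_apply, ← (summable_term a b n).tsum_const_smul]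
      exact tsum_congr fun k => by rw [smul_apply, smul_mul_assoc])
    (fun c a b => ext fun n => by
      rw [smul_apply, mul_apply, mul_apply, ← (summable_term a b n).tsum_const_smul]
      exact tsum_congr fun k => by rw [smul_apply, map_smul, mul_smul_comm])

instance : StarRing (Ell1 σ) where
  star_involutive a := ext fun n => by
    rw [star_apply, star_apply, map_star, star_star, alpha_alpha, neg_neg, add_neg_cancel,
      alpha_zero]
  star_mul a b := ext fun n => by
    rw [star_apply, mul_apply, mul_apply,
      (summable_term a b (-n)).map_tsum (alpha σ n) (continuous_alpha σ n), tsum_star,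
      ← (Equiv.subRight n).tsum_eq]
    refine tsum_congr fun k => ?_
    have e1 : -n - (k - n) = -k := by ring
    have e2 : n + (k - n) = k := by ring
    have e3 : -(n - k) = k - n := by ring
    have e4 : k + (n - k) = n := by ring
    simp only [Equiv.subRight_apply, star_apply, map_mul, map_star, alpha_alpha, star_mul, e1,
      e2, e3, e4]
  star_add a b := ext fun n => by
    rw [add_apply, star_apply, star_apply, star_apply, add_apply, map_add, star_add]

instance : StarModule ℂ (Ell1 σ) where
  star_smul c a := ext fun n => by
    rw [smul_apply, star_apply, star_apply, smul_apply, map_smul, star_smul]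

end Ell1

section IntegratedForm

variable {σ : X ≃ₜ X} {B : Type*} [CStarAlgebra B]

theorem covariance_zpow (ρ : C(X, ℂ) →⋆ₐ[ℂ] B) (U : unitary B)
    (h : ∀ f, (U : B) * ρ f = ρ (alpha σ 1 f) * U) (n : ℤ) (f : C(X, ℂ)) :
    ((U ^ n : unitary B) : B) * ρ f = ρ (alpha σ n f) * ((U ^ n : unitary B) : B) := by
  have hinv : ∀ g, ((U⁻¹ : unitary B) : B) * ρ g
      = ρ (alpha σ (-1) g) * ((U⁻¹ : unitary B) : B) := fun g => by
    have h1 := h (alpha σ (-1) g)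
    rw [alpha_alpha, add_neg_cancel, alpha_zero] at h1
    have h2 : ((U⁻¹ : unitary B) : B) * (U : B) = 1 := by
      rw [← Submonoid.coe_mul, inv_mul_cancel, Submonoid.coe_one]
    have h3 : (U : B) * ((U⁻¹ : unitary B) : B) = 1 := by
      rw [← Submonoid.coe_mul, mul_inv_cancel, Submonoid.coe_one]
    calc ((U⁻¹ : unitary B) : B) * ρ g
        = ((U⁻¹ : unitary B) : B) * (ρ g * U) * ((U⁻¹ : unitary B) : B) := by
          rw [mul_assoc, mul_assoc, h3, mul_one]
      _ = ρ (alpha σ (-1) g) * ((U⁻¹ : unitary B) : B) := by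
          rw [← h1, ← mul_assoc, h2, one_mul]
  induction n generalizing f with
  | zero => simp [alpha_zero]
  | succ n ih =>
    rw [zpow_add_one, Submonoid.coe_mul, mul_assoc, h, ← mul_assoc, ih, mul_assoc, alpha_alpha]
  | pred n ih =>
    rw [zpow_sub_one, Submonoid.coe_mul, mul_assoc, hinv, ← mul_assoc, ih, mul_assoc,
      alpha_alpha, ← sub_eq_add_neg]

theorem summable_norm_integrated (ρ : C(X, ℂ) →⋆ₐ[ℂ] B) (U : unitary B) (a : Ell1 σ) :
    Summable (fun n : ℤ => ‖ρ (a n) * ((U ^ n : unitary B) : B)‖) := by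
  refine Summable.of_nonneg_of_le (fun _ => norm_nonneg _) (fun n => ?_) a.summable_norm
  rw [CStarRing.norm_mul_coe_unitary]
  exact NonUnitalStarAlgHom.norm_apply_le ρ _

theorem summable_integrated (ρ : C(X, ℂ) →⋆ₐ[ℂ] B) (U : unitary B) (a : Ell1 σ) :
    Summable (fun n : ℤ => ρ (a n) * ((U ^ n : unitary B) : B)) :=
  (summable_norm_integrated ρ U a).of_norm

/-- The `*`-homomorphism `∑ fₙ δⁿ ↦ ∑ ρ(fₙ) Uⁿ` of `ℓ¹(Σ)` determined by a covariant pair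
`(ρ, U)`. -/
def integratedForm (ρ : C(X, ℂ) →⋆ₐ[ℂ] B) (U : unitary B)
    (h : ∀ f, (U : B) * ρ f = ρ (alpha σ 1 f) * U) : Ell1 σ →⋆ₐ[ℂ] B :=
  have hsingle : ∀ f : C(X, ℂ),
      ∑' n : ℤ, ρ ((Ell1.single 0 f : Ell1 σ) n) * ((U ^ n : unitary B) : B) = ρ f := fun f => by
    rw [tsum_eq_single 0 (fun n hn => by rw [Ell1.single_apply, if_neg hn, map_zero, zero_mul]),
      Ell1.single_apply, if_pos rfl, zpow_zero, Submonoid.coe_one, mul_one]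
  have hcont : Continuous ρ :=
    AddMonoidHomClass.continuous_of_bound ρ 1
      (fun f => by simpa using NonUnitalStarAlgHom.norm_apply_le ρ f)
  have hzero : ∑' n : ℤ, ρ ((0 : Ell1 σ) n) * ((U ^ n : unitary B) : B) = 0 := by
    have h0 : ∀ n : ℤ, ρ ((0 : Ell1 σ) n) * ((U ^ n : unitary B) : B) = 0 := fun n => by
      rw [Ell1.zero_apply, map_zero, zero_mul]
    rw [tsum_congr h0, tsum_zero]
  { toFun := fun a => ∑' n : ℤ, ρ (a n) * ((U ^ n : unitary B) : B)
    map_one' := (hsingle 1).trans (map_one ρ)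
    map_zero' := hzero
    map_add' := fun a b => by
      rw [← (summable_integrated ρ U a).tsum_add (summable_integrated ρ U b)]
      exact tsum_congr fun n => by rw [Ell1.add_apply, map_add, add_mul]
    commutes' := fun c => by
      have e : algebraMap ℂ (Ell1 σ) c = Ell1.single 0 (algebraMap ℂ C(X, ℂ) c) := by
        rw [Algebra.algebraMap_eq_smul_one, Algebra.algebraMap_eq_smul_one]
        refine Ell1.ext fun n => ?_
        rw [Ell1.smul_apply, Ell1.one_apply, Ell1.single_apply]
        split_ifs <;> simp
      rw [e, hsingle]
      exact AlgHomClass.commutes ρ c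
    map_mul' := fun a b => by
      rw [tsum_mul_tsum_of_summable_norm (summable_norm_integrated ρ U a)
        (summable_norm_integrated ρ U b)]
      refine Eq.trans ?_ (Ell1.convEquiv.tsum_eq _)
      have hs := summable_mul_of_summable_norm (summable_norm_integrated ρ U a)
        (summable_norm_integrated ρ U b)
      have hs' := Ell1.convEquiv.summable_iff.2 hs
      refine Eq.trans ?_ hs'.tsum_prod.symm
      refine tsum_congr fun n => ?_
      rw [Ell1.mul_apply, (Ell1.summable_term a b n).map_tsum ρ hcont,
        ← (show Summable (fun k : ℤ => ρ (a k * alpha σ k (b (n - k)))) from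
          (Ell1.summable_term a b n).map ρ hcont).tsum_mul_right]
      refine tsum_congr fun k => ?_
      have e : (U ^ n : unitary B) = U ^ k * U ^ (n - k) := by
        rw [← zpow_add, add_sub_cancel]
      simp only [Function.comp, Ell1.convEquiv, Equiv.coe_fn_mk]
      rw [map_mul, e, Submonoid.coe_mul, mul_assoc, mul_assoc,
        ← mul_assoc (ρ (alpha σ k _)), ← covariance_zpow ρ U h, mul_assoc]
    map_star' := fun a => by
      rw [tsum_star, ← (Equiv.neg ℤ).tsum_eq]
      refine tsum_congr fun n => ?_
      have e : star ((U ^ n : unitary B) : B) = ((U ^ (-n) : unitary B) : B) := by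
        rw [← Unitary.coe_star, Unitary.star_eq_inv, zpow_neg]
      rw [star_mul, e, ← map_star, covariance_zpow ρ U h, Equiv.neg_apply, Ell1.star_apply,
        neg_neg, map_star, map_star, map_star] }

end IntegratedForm

section PeriodicRep

/-- The Hilbert space with orthonormal basis `e₀, …, e_{p-1}`, where `p` is the period of `x`. -/
abbrev periodicSpace (σ : X ≃ₜ X) (x : X) : Type :=
  EuclideanSpace ℂ (Fin (Function.minimalPeriod σ x))

/-- The matrix with `e_j ↦ e_{j+1}` for `j + 1 < p` and `e_{p-1} ↦ z e₀`. -/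
def cyclicMatrix (p : ℕ) (z : ℂ) : Matrix (Fin p) (Fin p) ℂ :=
  fun i j => if (i : ℕ) = j + 1 then 1 else if (i : ℕ) = 0 ∧ (j : ℕ) + 1 = p then z else 0

/-- The cyclic successor on `Fin p`. -/
def cyclicSucc {p : ℕ} (j : Fin p) : Fin p :=
  if h : (j : ℕ) + 1 < p then ⟨j + 1, h⟩ else ⟨0, j.pos⟩

theorem cyclicSucc_injective {p : ℕ} : Function.Injective (cyclicSucc (p := p)) := by
  intro j k h
  have hj := j.isLt
  have hk := k.isLt
  unfold cyclicSucc at h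
  split_ifs at h <;> simp only [Fin.mk.injEq] at h <;> ext <;> omega

theorem cyclicMatrix_apply {p : ℕ} (z : ℂ) (i j : Fin p) :
    cyclicMatrix p z i j
      = if i = cyclicSucc j then (if (j : ℕ) + 1 < p then 1 else z) else 0 := by
  have hi := i.isLt
  have hj := j.isLt
  unfold cyclicMatrix cyclicSucc
  by_cases h : (j : ℕ) + 1 < p
  · have h2 : ¬ ((i : ℕ) = 0 ∧ (j : ℕ) + 1 = p) := by omega
    simp only [h, h2, dif_pos, if_true, if_false, Fin.ext_iff]
  · have h2 : (i : ℕ) ≠ j + 1 := by omega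
    have h3 : (j : ℕ) + 1 = p := by omega
    rw [dif_neg h, if_neg h, if_neg h2]
    simp only [h3, Fin.ext_iff, and_true]

theorem cyclicMatrix_star_mul (p : ℕ) (z : Circle) :
    star (cyclicMatrix p z) * cyclicMatrix p z = 1 := by
  have hz : (starRingEnd ℂ) (z : ℂ) * z = 1 := by
    rw [← Complex.normSq_eq_conj_mul_self, Circle.normSq_coe, Complex.ofReal_one]
  ext j k
  rw [Matrix.mul_apply, Finset.sum_eq_single (cyclicSucc k)
    (fun i _ hi => by rw [cyclicMatrix_apply _ i k, if_neg hi, mul_zero])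
    (fun h => absurd (Finset.mem_univ _) h), Matrix.star_apply, cyclicMatrix_apply,
    cyclicMatrix_apply]
  by_cases hjk : j = k
  · subst hjk
    by_cases h : (j : ℕ) + 1 < p <;> simp [h, hz]
  · have h : cyclicSucc k ≠ cyclicSucc j := fun h => hjk (cyclicSucc_injective h).symm
    simp [h, hjk]

theorem cyclicMatrix_mem (p : ℕ) (z : Circle) :
    cyclicMatrix p z ∈ unitary (Matrix (Fin p) (Fin p) ℂ) :=
  Unitary.mem_iff.2 ⟨cyclicMatrix_star_mul p z,
    mul_eq_one_comm.1 (cyclicMatrix_star_mul p z)⟩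

/-- The unitary operator `T_z` on the Hilbert space `H_{x,z}`. -/
def periodicUnitary (σ : X ≃ₜ X) (x : X) (z : Circle) :
    unitary (periodicSpace σ x →L[ℂ] periodicSpace σ x) :=
  ⟨Matrix.toEuclideanCLM (𝕜 := ℂ) (cyclicMatrix (Function.minimalPeriod σ x) z),
    Unitary.map_mem (Matrix.toEuclideanCLM (n := Fin (Function.minimalPeriod σ x)) (𝕜 := ℂ))
      (cyclicMatrix_mem _ z)⟩

/-- `f ↦ diag (f x, f (σ x), …, f (σ^{p-1} x))` as a matrix. -/
def diagonalHom (σ : X ≃ₜ X) (x : X) (p : ℕ) : C(X, ℂ) →⋆ₐ[ℂ] Matrix (Fin p) (Fin p) ℂ where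
  toFun f := Matrix.diagonal fun i : Fin p => f (σ^[i] x)
  map_one' := by simp
  map_mul' f g := by simp
  map_zero' := by simp
  map_add' f g := by simp
  commutes' c := by
    rw [Matrix.algebraMap_eq_diagonal]
    rfl
  map_star' f := by
    rw [Matrix.star_eq_conjTranspose, Matrix.diagonal_conjTranspose]
    rfl

/-- `f ↦ diag (f x, f (σ x), …, f (σ^{p-1} x))` as an operator on the Hilbert space `H_{x,z}`. -/
def periodicDiagonal (σ : X ≃ₜ X) (x : X) :
    C(X, ℂ) →⋆ₐ[ℂ] (periodicSpace σ x →L[ℂ] periodicSpace σ x) :=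
  (Matrix.toEuclideanCLM (n := Fin (Function.minimalPeriod σ x)) (𝕜 := ℂ) :
    Matrix _ _ ℂ →⋆ₐ[ℂ] _).comp (diagonalHom σ x (Function.minimalPeriod σ x))

theorem periodic_covariance (σ : X ≃ₜ X) (x : X) (z : Circle) (f : C(X, ℂ)) :
    (periodicUnitary σ x z : periodicSpace σ x →L[ℂ] periodicSpace σ x) * periodicDiagonal σ x f
      = periodicDiagonal σ x (alpha σ 1 f) * periodicUnitary σ x z := by
  have key : cyclicMatrix (Function.minimalPeriod σ x) z
        * diagonalHom σ x (Function.minimalPeriod σ x) f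
      = diagonalHom σ x (Function.minimalPeriod σ x) (alpha σ 1 f)
        * cyclicMatrix (Function.minimalPeriod σ x) z := by
    ext i j
    have hd : ∀ g, diagonalHom σ x (Function.minimalPeriod σ x) g
        = Matrix.diagonal fun i : Fin _ => g (σ^[i] x) := fun _ => rfl
    rw [hd, hd, Matrix.mul_diagonal, Matrix.diagonal_mul, cyclicMatrix_apply]
    by_cases h : i = cyclicSucc j
    · have hs : σ^[(i : ℕ)] x = σ (σ^[(j : ℕ)] x) := by
        rw [h, ← Function.iterate_succ_apply' σ]
        unfold cyclicSucc
        by_cases h : (j : ℕ) + 1 < Function.minimalPeriod σ x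
        · rw [dif_pos h]
        · have h3 : (j : ℕ).succ = Function.minimalPeriod σ x := by have := j.isLt; omega
          rw [dif_neg h, h3, Function.iterate_minimalPeriod]
          rfl
      have hf : alpha σ 1 f (σ^[(i : ℕ)] x) = f (σ^[(j : ℕ)] x) := by
        rw [alpha_apply, hs, zpow_neg_one]
        exact congrArg f (σ.symm_apply_apply _)
      rw [hf, mul_comm]
    · rw [if_neg h, zero_mul, mul_zero]
  have := congrArg (Matrix.toEuclideanCLM (𝕜 := ℂ)) key
  rwa [map_mul, map_mul] at this

/-- The `*`-representation `π_{x,z}` of `ℓ¹(Σ)` on the Hilbert space `H_{x,z}` associated with a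
periodic point `x` and `z ∈ 𝕋`; it sends `δ` to `T_z` and `f ∈ C(X)` to
`diag (f x, …, f (σ^{p-1} x))`. (If `x` is not periodic, then the space is zero.) -/
def periodicRep (σ : X ≃ₜ X) (x : X) (z : Circle) :
    Ell1 σ →⋆ₐ[ℂ] (periodicSpace σ x →L[ℂ] periodicSpace σ x) :=
  integratedForm (periodicDiagonal σ x) (periodicUnitary σ x z) (periodic_covariance σ x z)

/-- `π_{x,z}`, viewed as a representation on a vector space. -/
def periodicAlgRep (σ : X ≃ₜ X) (x : X) (z : Circle) :
    Ell1 σ →ₙₐ[ℂ] Module.End ℂ (periodicSpace σ x) where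
  toFun a := (periodicRep σ x z a : periodicSpace σ x →ₗ[ℂ] periodicSpace σ x)
  map_smul' c a := by
    rw [map_smul]
    rfl
  map_zero' := by
    rw [map_zero]
    rfl
  map_add' a b := by
    rw [map_add]
    rfl
  map_mul' a b := by
    rw [map_mul]
    rfl

end PeriodicRep

section Representations

variable {A : Type*} [Ring A] [Algebra ℂ A]

/-- Algebraic irreducibility of a (not necessarily unital) representation on a vector space. -/
def IsAlgIrreducible {E : Type*} [AddCommGroup E] [Module ℂ E]
    (π : A →ₙₐ[ℂ] Module.End ℂ E) : Prop :=
  (∃ a e, π a e ≠ 0) ∧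
    ∀ W : Submodule ℂ E, (∀ a, ∀ w ∈ W, π a w ∈ W) → W = ⊥ ∨ W = ⊤

/-- Algebraic equivalence of representations: there is an intertwining linear bijection. -/
def AlgEquivalent {E F : Type*} [AddCommGroup E] [Module ℂ E] [AddCommGroup F] [Module ℂ F]
    (π : A →ₙₐ[ℂ] Module.End ℂ E) (ρ : A →ₙₐ[ℂ] Module.End ℂ F) : Prop :=
  ∃ T : E ≃ₗ[ℂ] F, ∀ a e, T (π a e) = ρ a (T e)

/-- The vector space `E` can be given an inner product for which it is a Hilbert space and `π` is
a `*`-representation by bounded operators. -/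
def IsStarRealizable [StarRing A] {E : Type*} [AddCommGroup E] [Module ℂ E]
    (π : A →ₙₐ[ℂ] Module.End ℂ E) : Prop :=
  ∃ c : InnerProductSpace.Core ℂ E,
    letI : NormedAddCommGroup E := c.toNormedAddCommGroup
    letI : InnerProductSpace ℂ E := InnerProductSpace.ofCore c.toCore
    ∃ _ : CompleteSpace E, ∃ ρ : A →⋆ₙₐ[ℂ] (E →L[ℂ] E), ∀ a e, ρ a e = π a e

/-- An algebraically irreducible representation of `A` on some complex vector space. -/
structure IrrRep (A : Type*) [Ring A] [Algebra ℂ A] where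
  /-- the representation space -/
  E : Type v
  [addCommGroup : AddCommGroup E]
  [module : Module ℂ E]
  /-- the representation -/
  π : A →ₙₐ[ℂ] Module.End ℂ E
  irreducible : IsAlgIrreducible π

attribute [instance] IrrRep.addCommGroup IrrRep.module

/-- Algebraic equivalence as an equivalence relation on algebraically irreducible
representations. -/
instance IrrRep.setoid (A : Type*) [Ring A] [Algebra ℂ A] : Setoid (IrrRep.{v} A) where
  r π ρ := AlgEquivalent π.π ρ.π
  iseqv :=
    { refl := fun _ => ⟨LinearEquiv.refl ℂ _, fun _ _ => rfl⟩
      symm := fun ⟨T, hT⟩ => ⟨T.symm, fun a e => by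
        rw [LinearEquiv.symm_apply_eq, hT, LinearEquiv.apply_symm_apply]⟩
      trans := fun ⟨T, hT⟩ ⟨S, hS⟩ => ⟨T.trans S, fun a e => by
        rw [LinearEquiv.trans_apply, LinearEquiv.trans_apply, hT, hS]⟩ }

/-- The algebraic equivalence classes of algebraically irreducible representations of `A`. -/
abbrev IrrRepClass (A : Type*) [Ring A] [Algebra ℂ A] := Quotient (IrrRep.setoid.{v} A)

/-- Primitive ideals: kernels of algebraically irreducible representations. -/
def IsPrimitiveIdeal (I : TwoSidedIdeal A) : Prop :=
  ∃ π : IrrRep.{v} A, ∀ a, a ∈ I ↔ π.π a = 0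

end Representations

/-- The orbit space `X/ℤ` of the `ℤ`-action generated by `σ`. -/
abbrev OrbitSpace {X : Type u} [TopologicalSpace X] (σ : X ≃ₜ X) : Type u :=
  Quotient (Equiv.Perm.SameCycle.setoid (σ.toEquiv : Equiv.Perm X))

end DynSys

end

/-! A finite Hausdorff space is discrete and all its points are periodic. Let `π` be irreducible on
`E`. It is unital and `1 = ∑ 1_{x}`, so some `π(1_{x})` is nonzero; a nonzero `v` in its range is a
joint eigenvector, `π(f) v = f(x) v`.

Let `p` be the period of `x` and `χ` the characteristic function of its orbit. Since `σ^p` is the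
identity on the orbit, `χ δ^p` and `χ δ^{-p}` are central. Schur's lemma for Banach algebras
(`exists_scalar_of_central`) makes them act on `v` as scalars bounded by their norms, hence by 1.
The two scalars are mutually inverse, so `δ^p v = λ v` with `|λ| = 1`
(`IsAlgIrreducible.exists_circle`).

Now `e_j ↦ π(δ^j) v` intertwines `π_{x,λ}` and `π` on `C(X)` and `δ^{±1}`. No continuity of `π` is
assumed, but the annihilator of `v` is a maximal left ideal, hence closed, and this carries the
relation to the whole algebra (`IsAlgIrreducible.orbitMap_intertwines`). Both representations are
irreducible, so the map is an equivalence.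

The orbit is recovered from which `1_{x}` act nontrivially, and `λ` from the action of `δ^p`. Finite
dimension, the Hilbert space structure and selfadjoint kernels are inherited from `π_{x,λ}`. -/

noncomputable section

namespace DynSys

/-! ### Central elements acting on simple modules -/

section CentralElements

variable {A : Type*} [NormedRing A] [NormedAlgebra ℂ A] [CompleteSpace A]

/-- **Schur's lemma for Banach algebras**: a central element acts as a scalar on the simple
module `A ⧸ I`. -/
theorem exists_scalar_of_central {z : A} (hz : ∀ a, z * a = a * z) (I : Ideal A)
    [hI : I.IsMaximal] : ∃ μ : ℂ, ‖μ‖ ≤ ‖z‖ ∧ z - algebraMap ℂ A μ ∈ I := by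
  have hsimple : IsSimpleModule A (A ⧸ I) := isSimpleModule_iff_isCoatom.2 hI.out
  have hnt : Nontrivial (A ⧸ I) := Submodule.Quotient.nontrivial_iff.2 hI.ne_top
  let L : (A ⧸ I) →ₗ[ℂ] (A ⧸ I) :=
    { toFun := fun q => z • q
      map_add' := smul_add z
      map_smul' := fun c q => by
        rw [RingHom.id_apply, ← algebraMap_smul A c q, ← algebraMap_smul A c (z • q), smul_smul,
          smul_smul, hz] }
  -- The quotient norm is an infimum, so a representative is chosen up to a small error; `‖z‖ + 1`
  -- avoids dividing by zero.
  have hL : ∀ q, ‖L q‖ ≤ ‖z‖ * ‖q‖ := fun q => by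
    refine le_of_forall_pos_le_add fun ε hε => ?_
    obtain ⟨a, rfl, ha⟩ := Submodule.Quotient.norm_mk_lt q
      (show 0 < ε / (‖z‖ + 1) by positivity)
    calc ‖L (Submodule.Quotient.mk a)‖ ≤ ‖z * a‖ :=
          Submodule.Quotient.norm_mk_le (S := I) (z * a)
      _ ≤ ‖z‖ * ‖a‖ := norm_mul_le _ _
      _ ≤ ‖z‖ * (‖(Submodule.Quotient.mk a : A ⧸ I)‖ + ε / (‖z‖ + 1)) := by gcongr
      _ ≤ ‖z‖ * ‖(Submodule.Quotient.mk a : A ⧸ I)‖ + ε := by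
          have : ‖z‖ * (ε / (‖z‖ + 1)) ≤ ε := by
            rw [mul_div_assoc', div_le_iff₀ (by positivity)]
            nlinarith [norm_nonneg z]
          linarith
  let Z : (A ⧸ I) →L[ℂ] (A ⧸ I) := L.mkContinuous ‖z‖ hL
  have hZ : ∀ q, Z q = z • q := fun _ => rfl
  -- A maximal left ideal is closed, so `A ⧸ I` is a nonzero Banach space and `Z` has nonempty
  -- spectrum.
  obtain ⟨μ, hμ⟩ := spectrum.nonempty Z
  have hbound : ‖μ‖ ≤ ‖z‖ :=
    (spectrum.norm_le_norm_of_mem hμ).trans (L.mkContinuous_norm_le (norm_nonneg z) hL)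
  let S : (A ⧸ I) →ₗ[A] (A ⧸ I) :=
    { toFun := fun q => algebraMap ℂ A μ • q - z • q
      map_add' := fun q r => by simp only [smul_add]; abel
      map_smul' := fun a q => by
        rw [RingHom.id_apply, smul_sub, smul_smul, smul_smul, smul_smul, smul_smul, hz,
          Algebra.commutes] }
  refine ⟨μ, hbound, ?_⟩
  -- `S = μ - z` is `A`-linear because `z` is central. Were it bijective, the open mapping theorem
  -- would make `μ - Z` invertible, against `μ ∈ spectrum`. So `S = 0`, and evaluating at the class
  -- of `1` gives the claim.
  rcases S.bijective_or_eq_zero with hS | hS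
  · refine absurd (ContinuousLinearMap.isUnit_iff_bijective.2 ?_) hμ
    convert hS using 1
    ext q
    change (algebraMap ℂ ((A ⧸ I) →L[ℂ] (A ⧸ I)) μ) q - Z q = algebraMap ℂ A μ • q - z • q
    rw [hZ, algebraMap_smul, Algebra.algebraMap_eq_smul_one]
    rfl
  · have h1 : algebraMap ℂ A μ • (Submodule.Quotient.mk 1 : A ⧸ I)
        - z • (Submodule.Quotient.mk 1 : A ⧸ I) = 0 :=
      LinearMap.congr_fun hS _
    rw [← Submodule.Quotient.mk_smul, ← Submodule.Quotient.mk_smul, ← Submodule.Quotient.mk_sub,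
      Submodule.Quotient.mk_eq_zero, smul_eq_mul, smul_eq_mul, mul_one, mul_one] at h1
    rw [← neg_sub]
    exact I.neg_mem h1

end CentralElements

/-! ### Algebraically irreducible representations -/

section Irreducible

variable {A : Type*} [Ring A] [Algebra ℂ A] {E : Type*} [AddCommGroup E] [Module ℂ E]
  {π : A →ₙₐ[ℂ] Module.End ℂ E}

/-- The range of `π 1` is invariant. If it were zero, all of `π` would vanish; and an idempotent
with full range is the identity. -/
theorem IsAlgIrreducible.apply_one (hπ : IsAlgIrreducible π) : π 1 = 1 := by
  have hinv : ∀ a, ∀ w ∈ LinearMap.range (π 1), π a w ∈ LinearMap.range (π 1) := by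
    rintro a _ ⟨e, rfl⟩
    refine ⟨π a e, ?_⟩
    rw [← Module.End.mul_apply, ← Module.End.mul_apply, ← map_mul, ← map_mul, mul_one, one_mul]
  rcases hπ.2 _ hinv with h | h
  · obtain ⟨a, e, hae⟩ := hπ.1
    refine absurd ?_ hae
    rw [← one_mul a, map_mul, LinearMap.range_eq_bot.1 h, zero_mul, LinearMap.zero_apply]
  · ext e
    obtain ⟨f, rfl⟩ := LinearMap.range_eq_top.1 h e
    rw [← Module.End.mul_apply, ← map_mul, one_mul, Module.End.one_apply]

/-- Since `I` is a left ideal, `I v` is an invariant subspace, hence everything once it is nonzero.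
-/
theorem IsAlgIrreducible.exists_apply_eq (hπ : IsAlgIrreducible π) (I : Ideal A) {v : E}
    (h : ∃ a ∈ I, π a v ≠ 0) (e : E) : ∃ a ∈ I, π a v = e := by
  let W : Submodule ℂ E :=
    { carrier := {e | ∃ a ∈ I, π a v = e}
      add_mem' := by
        rintro _ _ ⟨a, ha, rfl⟩ ⟨b, hb, rfl⟩
        exact ⟨a + b, I.add_mem ha hb, by rw [map_add, LinearMap.add_apply]⟩
      zero_mem' := ⟨0, I.zero_mem, by rw [map_zero, LinearMap.zero_apply]⟩
      smul_mem' := by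
        rintro c _ ⟨a, ha, rfl⟩
        refine ⟨c • a, ?_, by rw [map_smul, LinearMap.smul_apply]⟩
        rw [Algebra.smul_def]
        exact I.mul_mem_left _ ha }
  have hinv : ∀ a, ∀ w ∈ W, π a w ∈ W := by
    rintro a _ ⟨b, hb, rfl⟩
    exact ⟨a * b, I.mul_mem_left _ hb, by rw [map_mul, Module.End.mul_apply]⟩
  rcases hπ.2 W hinv with hW | hW
  · obtain ⟨a, ha, hav⟩ := h
    have : π a v ∈ W := ⟨a, ha, rfl⟩
    rw [hW, Submodule.mem_bot] at this
    exact absurd this hav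
  · have : e ∈ W := hW ▸ Submodule.mem_top
    exact this

/-- The left ideal of the elements that annihilate the vector `v`. -/
def annihilatorOf (π : A →ₙₐ[ℂ] Module.End ℂ E) (v : E) : Ideal A where
  carrier := {a | π a v = 0}
  add_mem' {a b} (ha hb) := by
    simp only [Set.mem_ofPred_eq] at *
    rw [map_add, LinearMap.add_apply, ha, hb, add_zero]
  zero_mem' := by simp
  smul_mem' a b hb := by
    simp only [Set.mem_ofPred_eq] at *
    rw [smul_eq_mul, map_mul, Module.End.mul_apply, hb, map_zero]

theorem mem_annihilatorOf {v : E} {a : A} : a ∈ annihilatorOf π v ↔ π a v = 0 := Iff.rfl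

/-- A strictly larger left ideal `J` satisfies `J v = E`, so some `b ∈ J` fixes `v`. Then `1 - b`
annihilates `v` and lies in `J`, whence `1 ∈ J`. -/
theorem IsAlgIrreducible.isMaximal_annihilatorOf (hπ : IsAlgIrreducible π) {v : E} (hv : v ≠ 0) :
    (annihilatorOf π v).IsMaximal := by
  refine ⟨⟨fun h => hv ?_, fun J hJ => ?_⟩⟩
  · have h1 : π 1 v = 0 := mem_annihilatorOf.1 (h ▸ Submodule.mem_top)
    rwa [hπ.apply_one] at h1
  · obtain ⟨hle, a, haJ, ha⟩ := Set.ssubset_iff_exists.1 hJ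
    obtain ⟨b, hb, hbv⟩ := hπ.exists_apply_eq J ⟨a, haJ, ha⟩ v
    have h1 : 1 - b ∈ J := hle (by
      change π (1 - b) v = 0
      rw [map_sub, LinearMap.sub_apply, hπ.apply_one, hbv, Module.End.one_apply, sub_self])
    rw [Ideal.eq_top_iff_one]
    simpa using J.add_mem h1 hb

theorem IsAlgIrreducible.map_algebraMap (hπ : IsAlgIrreducible π) (c : ℂ) (e : E) :
    π (algebraMap ℂ A c) e = c • e := by
  rw [Algebra.algebraMap_eq_smul_one, map_smul, hπ.apply_one]
  rfl

theorem IsAlgIrreducible.of_algEquivalent {F : Type*} [AddCommGroup F] [Module ℂ F]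
    {ρ : A →ₙₐ[ℂ] Module.End ℂ F} (hπ : IsAlgIrreducible π) (h : AlgEquivalent π ρ) :
    IsAlgIrreducible ρ := by
  obtain ⟨T, hT⟩ := h
  refine ⟨?_, fun W hW => ?_⟩
  · obtain ⟨a, e, hae⟩ := hπ.1
    exact ⟨a, T e, fun h => hae (T.map_eq_zero_iff.1 ((hT a e).trans h))⟩
  · have hTW : W = (W.comap (T : E →ₗ[ℂ] F)).map (T : E →ₗ[ℂ] F) :=
      (Submodule.map_comap_eq_of_surjective T.surjective W).symm
    rcases hπ.2 (W.comap (T : E →ₗ[ℂ] F)) (fun a w hw => by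
      rw [Submodule.mem_comap] at hw ⊢
      exact (hT a w).symm ▸ hW a _ hw) with h | h
    · left
      rw [hTW, h, Submodule.map_bot]
    · right
      rw [hTW, h, Submodule.map_top, LinearEquiv.range]

/-- **Schur's lemma**: an intertwining map between irreducible representations that is not zero
is an equivalence. -/
theorem algEquivalent_of_intertwining {F : Type*} [AddCommGroup F] [Module ℂ F]
    {ρ : A →ₙₐ[ℂ] Module.End ℂ F} (hπ : IsAlgIrreducible π) (hρ : IsAlgIrreducible ρ)
    (T : E →ₗ[ℂ] F) (hT : ∀ a e, T (π a e) = ρ a (T e)) (hT0 : T ≠ 0) : AlgEquivalent π ρ := by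
  have hker : LinearMap.ker T = ⊥ := (hπ.2 (LinearMap.ker T) fun a e he => by
    rw [LinearMap.mem_ker] at he ⊢
    rw [hT, he, map_zero]).resolve_right fun h => hT0 (LinearMap.ker_eq_top.1 h)
  have hrange : LinearMap.range T = ⊤ := (hρ.2 (LinearMap.range T) fun a f hf => by
    obtain ⟨e, rfl⟩ := hf
    exact ⟨π a e, hT a e⟩).resolve_left fun h => hT0 (LinearMap.range_eq_bot.1 h)
  exact ⟨LinearEquiv.ofBijective T ⟨LinearMap.ker_eq_bot.1 hker, LinearMap.range_eq_top.1 hrange⟩,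
    hT⟩

end Irreducible

section BanachIrreducible

variable {A : Type*} [NormedRing A] [NormedAlgebra ℂ A] [CompleteSpace A]
  {E : Type*} [AddCommGroup E] [Module ℂ E] {π : A →ₙₐ[ℂ] Module.End ℂ E}

/-- This replaces continuity of `π`: maximal left ideals of a Banach algebra are closed. -/
theorem IsAlgIrreducible.isClosed_annihilatorOf (hπ : IsAlgIrreducible π) (v : E) :
    IsClosed {a | π a v = 0} := by
  rcases eq_or_ne v 0 with rfl | hv
  · simp
  · have := hπ.isMaximal_annihilatorOf hv
    exact Ideal.IsMaximal.isClosed (I := annihilatorOf π v)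

theorem IsAlgIrreducible.exists_scalar_of_central (hπ : IsAlgIrreducible π) {z : A}
    (hz : ∀ a, z * a = a * z) {v : E} (hv : v ≠ 0) : ∃ μ : ℂ, ‖μ‖ ≤ ‖z‖ ∧ π z v = μ • v := by
  have := hπ.isMaximal_annihilatorOf hv
  obtain ⟨μ, hμ, h⟩ := DynSys.exists_scalar_of_central hz (annihilatorOf π v)
  refine ⟨μ, hμ, ?_⟩
  rwa [mem_annihilatorOf, map_sub, LinearMap.sub_apply, hπ.map_algebraMap, sub_eq_zero] at h

end BanachIrreducible

/-! ### The Banach algebra structure and its monomials -/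

namespace Ell1

variable {X : Type u} [TopologicalSpace X] [CompactSpace X] {σ : X ≃ₜ X}

theorem norm_mul_le (a b : Ell1 σ) : ‖a * b‖ ≤ ‖a‖ * ‖b‖ := by
  have hab := a.summable_norm.mul_of_nonneg b.summable_norm (fun _ => norm_nonneg _)
    (fun _ => norm_nonneg _)
  rw [norm_def, norm_def a, norm_def b,
    a.summable_norm.tsum_mul_tsum b.summable_norm hab]
  calc ∑' n, ‖(a * b) n‖
      ≤ ∑' n, ∑' k, ‖a k * alpha σ k (b (n - k))‖ :=
        (summable_mul a b).tsum_le_tsum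
          (fun n => norm_tsum_le_tsum_norm (summable_conv_right a b n)) (summable_conv a b).prod
    _ = ∑' p : ℤ × ℤ, ‖a p.2 * alpha σ p.2 (b (p.1 - p.2))‖ := (summable_conv a b).tsum_prod.symm
    _ = ∑' p : ℤ × ℤ, ‖a p.1 * alpha σ p.1 (b p.2)‖ :=
        convEquiv.tsum_eq (fun p : ℤ × ℤ => ‖a p.1 * alpha σ p.1 (b p.2)‖)
    _ ≤ ∑' p : ℤ × ℤ, ‖a p.1‖ * ‖b p.2‖ :=
        (summable_pair a b).tsum_le_tsum (fun p => (_root_.norm_mul_le _ _).trans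
          (mul_le_mul_of_nonneg_left (norm_alpha_le σ _ _) (norm_nonneg _))) hab

instance : NormedRing (Ell1 σ) :=
  { (inferInstance : NormedAddCommGroup (Ell1 σ)), (inferInstance : Ring (Ell1 σ)) with
    norm_mul_le := norm_mul_le }

instance : NormedAlgebra ℂ (Ell1 σ) :=
  { (inferInstance : Algebra ℂ (Ell1 σ)) with
    norm_smul_le := fun c a => norm_smul_le c a }

theorem norm_single (m : ℤ) (f : C(X, ℂ)) : ‖(single m f : Ell1 σ)‖ = ‖f‖ := by
  rw [norm_def, tsum_eq_single m (fun n hn => by rw [single_apply, if_neg hn, norm_zero]),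
    single_apply, if_pos rfl]

theorem mul_single_apply (a : Ell1 σ) (m : ℤ) (f : C(X, ℂ)) (n : ℤ) :
    (a * single m f : Ell1 σ) n = a (n - m) * alpha σ (n - m) f := by
  rw [mul_apply, tsum_eq_single (n - m) (fun k hk => by
    rw [single_apply, if_neg (fun h => hk (by rw [← h]; ring)), map_zero, mul_zero]),
    single_apply, if_pos (by ring)]

theorem single_mul_apply (a : Ell1 σ) (m : ℤ) (f : C(X, ℂ)) (n : ℤ) :
    (single m f * a : Ell1 σ) n = f * alpha σ m (a (n - m)) := by
  rw [mul_apply, tsum_eq_single m (fun k hk => by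
    rw [single_apply, if_neg hk, zero_mul]), single_apply, if_pos rfl]

theorem single_mul_single (m n : ℤ) (f g : C(X, ℂ)) :
    (single m f * single n g : Ell1 σ) = single (m + n) (f * alpha σ m g) := by
  refine ext fun k => ?_
  rw [single_mul_apply, single_apply, single_apply]
  by_cases h : k = m + n
  · rw [if_pos h, if_pos (by rw [h]; ring)]
  · rw [if_neg h, if_neg (fun h' => h (by rw [← h']; ring)), map_zero, mul_zero]

theorem single_zero_one : (single 0 1 : Ell1 σ) = 1 := rfl

theorem single_natCast_one (n : ℕ) : (single n 1 : Ell1 σ) = single 1 1 ^ n := by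
  induction n with
  | zero => rfl
  | succ n ih => rw [pow_succ, ← ih, single_mul_single, map_one, mul_one]; norm_cast

theorem single_neg_natCast_one (n : ℕ) : (single (-n) 1 : Ell1 σ) = single (-1) 1 ^ n := by
  induction n with
  | zero => rw [pow_zero, Nat.cast_zero, neg_zero, single_zero_one]
  | succ n ih =>
    rw [pow_succ, ← ih, single_mul_single, map_one, mul_one]
    congr 1
    push_cast
    ring

theorem hasSum_single (a : Ell1 σ) : HasSum (fun n => (single n (a n) : Ell1 σ)) a := by
  have h := lp.hasSum_single (p := 1) (by simp) a.toLp
  have e : (fun n => (single n (a n) : Ell1 σ)) = fun n => lp.single 1 n (a.toLp n) := by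
    funext n
    refine ext fun k => ?_
    rw [single_apply]
    split_ifs with hk
    · subst hk
      exact (lp.single_apply_self (E := fun _ : ℤ => C(X, ℂ)) 1 k (a k)).symm
    · exact (lp.single_apply_ne (E := fun _ : ℤ => C(X, ℂ)) 1 n (a n) hk).symm
  rw [e]
  exact h

/-- `ℓ¹(Σ)` is generated by `C(X)`, `δ` and `δ⁻¹` as a Banach algebra. -/
theorem mem_of_isClosed (S : Subalgebra ℂ (Ell1 σ)) (hS : IsClosed (S : Set (Ell1 σ)))
    (h0 : ∀ f, single 0 f ∈ S) (h1 : single 1 1 ∈ S) (h2 : single (-1) 1 ∈ S) (a : Ell1 σ) :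
    a ∈ S := by
  have hone : ∀ n : ℤ, (single n 1 : Ell1 σ) ∈ S := fun n => by
    obtain ⟨m, rfl | rfl⟩ := n.eq_nat_or_neg
    · rw [single_natCast_one]
      exact S.pow_mem h1 m
    · rw [single_neg_natCast_one]
      exact S.pow_mem h2 m
  have hsingle : ∀ n f, (single n f : Ell1 σ) ∈ S := fun n f => by
    have h := S.mul_mem (h0 f) (hone n)
    rwa [single_mul_single, map_one, mul_one, zero_add] at h
  exact hS.mem_of_tendsto a.hasSum_single
    (Filter.Eventually.of_forall fun s => S.sum_mem fun n _ => hsingle n _)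

theorem single_mul_single_zero (f g : C(X, ℂ)) :
    (single 0 f * single 0 g : Ell1 σ) = single 0 (f * g) := by
  rw [single_mul_single, alpha_zero, add_zero]

end Ell1

/-! ### Integrated forms: values on monomials and contractivity -/

section IntegratedForm

variable {X : Type u} [TopologicalSpace X] [CompactSpace X] {σ : X ≃ₜ X}
  {B : Type*} [CStarAlgebra B]

theorem integratedForm_single (ρ : C(X, ℂ) →⋆ₐ[ℂ] B) (U : unitary B)
    (h : ∀ f, (U : B) * ρ f = ρ (alpha σ 1 f) * U) (n : ℤ) (f : C(X, ℂ)) :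
    integratedForm ρ U h (Ell1.single n f) = ρ f * ((U ^ n : unitary B) : B) := by
  change ∑' k : ℤ, ρ ((Ell1.single n f : Ell1 σ) k) * ((U ^ k : unitary B) : B) = _
  rw [tsum_eq_single n (fun k hk => by rw [Ell1.single_apply, if_neg hk, map_zero, zero_mul]),
    Ell1.single_apply, if_pos rfl]

theorem norm_integratedForm_le (ρ : C(X, ℂ) →⋆ₐ[ℂ] B) (U : unitary B)
    (h : ∀ f, (U : B) * ρ f = ρ (alpha σ 1 f) * U) (a : Ell1 σ) :
    ‖integratedForm ρ U h a‖ ≤ ‖a‖ := by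
  have hs := summable_norm_integrated ρ U a
  rw [Ell1.norm_def]
  refine (norm_tsum_le_tsum_norm hs).trans (hs.tsum_le_tsum (fun n => ?_) a.summable_norm)
  rw [CStarRing.norm_mul_coe_unitary]
  exact NonUnitalStarAlgHom.norm_apply_le ρ _

theorem continuous_integratedForm (ρ : C(X, ℂ) →⋆ₐ[ℂ] B) (U : unitary B)
    (h : ∀ f, (U : B) * ρ f = ρ (alpha σ 1 f) * U) : Continuous (integratedForm ρ U h) :=
  AddMonoidHomClass.continuous_of_bound (integratedForm ρ U h) 1
    (fun a => by simpa using norm_integratedForm_le ρ U h a)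

end IntegratedForm

/-! ### The representations of periodic points -/

section PeriodicRep

variable {X : Type u} [TopologicalSpace X] [CompactSpace X] (σ : X ≃ₜ X)

open Function

theorem periodicAlgRep_apply (x : X) (z : Circle) (a : Ell1 σ) (e : periodicSpace σ x) :
    periodicAlgRep σ x z a e = periodicRep σ x z a e := rfl

/-- The orthonormal basis vector `e_j` of `H_{x,z}`. -/
abbrev periodicBasis (x : X) (j : Fin (minimalPeriod σ x)) : periodicSpace σ x :=
  EuclideanSpace.single j 1

theorem sum_periodicBasis (x : X) (e : periodicSpace σ x) :
    ∑ j, e j • periodicBasis σ x j = e := by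
  ext i
  simp [Pi.single_apply]

theorem periodicRep_single_zero_apply (x : X) (z : Circle) (f : C(X, ℂ))
    (e : periodicSpace σ x) (i : Fin (minimalPeriod σ x)) :
    periodicRep σ x z (Ell1.single 0 f) e i = f (σ^[i] x) * e i := by
  rw [periodicRep, integratedForm_single, zpow_zero, Submonoid.coe_one, mul_one]
  change (Matrix.toEuclideanCLM (𝕜 := ℂ) (Matrix.diagonal fun i : Fin _ => f (σ^[i] x)) e) i = _
  rw [Matrix.ofLp_toEuclideanCLM, Matrix.mulVec_diagonal]

theorem periodicRep_single_zero_basis (x : X) (z : Circle) (f : C(X, ℂ))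
    (j : Fin (minimalPeriod σ x)) :
    periodicRep σ x z (Ell1.single 0 f) (periodicBasis σ x j)
      = f (σ^[j] x) • periodicBasis σ x j := by
  ext i
  rw [periodicRep_single_zero_apply]
  by_cases h : i = j
  · subst h; simp
  · simp [h]

theorem periodicRep_single_one_basis (x : X) (z : Circle) (j : Fin (minimalPeriod σ x)) :
    periodicRep σ x z (Ell1.single 1 1) (periodicBasis σ x j)
      = (if (j : ℕ) + 1 < minimalPeriod σ x then 1 else (z : ℂ)) •
        periodicBasis σ x (cyclicSucc j) := by
  rw [periodicRep, integratedForm_single, map_one, one_mul, zpow_one]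
  change Matrix.toEuclideanCLM (𝕜 := ℂ) (cyclicMatrix _ z) _ = _
  ext i
  rw [Matrix.ofLp_toEuclideanCLM, PiLp.smul_apply]
  by_cases h : i = cyclicSucc j
  · subst h
    simp [cyclicMatrix_apply]
  · simp [cyclicMatrix_apply, h]

/-- `T_z^k e_0 = e_k` for `k < p`. -/
theorem periodicRep_single_one_pow_basis_zero (x : X) (z : Circle) (hp : 0 < minimalPeriod σ x)
    (k : ℕ) (hk : k < minimalPeriod σ x) :
    (periodicRep σ x z (Ell1.single 1 1) ^ k) (periodicBasis σ x ⟨0, hp⟩)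
      = periodicBasis σ x ⟨k, hk⟩ := by
  induction k with
  | zero => rfl
  | succ k ih =>
    rw [pow_succ', mul_apply_eq_comp, ih (by omega), periodicRep_single_one_basis]
    simp [cyclicSucc, hk]

/-- `T_z^p = z`. -/
theorem periodicRep_single_minimalPeriod (x : X) (z : Circle) (e : periodicSpace σ x) :
    periodicRep σ x z (Ell1.single (minimalPeriod σ x) 1) e = (z : ℂ) • e := by
  rw [Ell1.single_natCast_one, map_pow]
  set T := periodicRep σ x z (Ell1.single 1 1)
  have hbasis : ∀ j, (T ^ minimalPeriod σ x) (periodicBasis σ x j)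
      = (z : ℂ) • periodicBasis σ x j := fun j => by
    have hp : 0 < minimalPeriod σ x := j.pos
    have h0 : (T ^ minimalPeriod σ x) (periodicBasis σ x ⟨0, hp⟩)
        = (z : ℂ) • periodicBasis σ x ⟨0, hp⟩ := by
      have h1 : ∀ q, q + 1 = minimalPeriod σ x → (T ^ (q + 1)) (periodicBasis σ x ⟨0, hp⟩)
          = (z : ℂ) • periodicBasis σ x ⟨0, hp⟩ := fun q hq => by
        rw [pow_succ', mul_apply_eq_comp,
          periodicRep_single_one_pow_basis_zero σ x z hp q (by omega),
          periodicRep_single_one_basis]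
        simp [cyclicSucc, hq]
      have h2 := h1 (minimalPeriod σ x - 1) (by omega)
      rwa [Nat.sub_add_cancel hp] at h2
    -- `e_j = T^j e_0` and `T^p` commutes with `T^j`, so the value at `e_0` decides.
    rw [← periodicRep_single_one_pow_basis_zero σ x z hp j j.isLt, ← mul_apply_eq_comp,
      ← pow_add, add_comm, pow_add, mul_apply_eq_comp, h0, map_smul]
  conv_lhs => rw [← sum_periodicBasis σ x e]
  rw [map_sum]
  conv_rhs => rw [← sum_periodicBasis σ x e, Finset.smul_sum]
  refine Finset.sum_congr rfl fun j _ => ?_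
  rw [map_smul, hbasis, smul_comm]

/-- On a finite discrete space, the characteristic function of a set. -/
def indicatorMap [DiscreteTopology X] (S : Set X) : C(X, ℂ) :=
  ⟨S.indicator 1, continuous_of_discreteTopology⟩

theorem indicatorMap_of_mem [DiscreteTopology X] {S : Set X} {x : X} (h : x ∈ S) :
    indicatorMap S x = 1 := Set.indicator_of_mem h _

theorem indicatorMap_of_notMem [DiscreteTopology X] {S : Set X} {x : X} (h : x ∉ S) :
    indicatorMap S x = 0 := Set.indicator_of_notMem h _

theorem minimalPeriod_pos [Finite X] (x : X) : 0 < minimalPeriod σ x :=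
  minimalPeriod_pos_of_mem_periodicPts (σ.injective.mem_periodicPts x)

/-- The points `σ^j x`, `j < p`, are distinct, so characteristic functions of points project a
nonzero vector onto a nonzero multiple of some `e_i`. The weighted cyclic shift, with nonzero
weights, then reaches every basis vector. -/
theorem isAlgIrreducible_periodicAlgRep [DiscreteTopology X] [Finite X] (x : X) (z : Circle) :
    IsAlgIrreducible (periodicAlgRep σ x z) := by
  have hp := minimalPeriod_pos σ x
  refine ⟨⟨1, periodicBasis σ x ⟨0, hp⟩, ?_⟩, fun W hW => ?_⟩
  · rw [periodicAlgRep_apply, map_one, one_apply_eq_self]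
    exact fun h => by simpa using congrArg (fun e : periodicSpace σ x => e ⟨0, hp⟩) h
  · rw [or_iff_not_imp_left]
    intro hne
    obtain ⟨w, hw, hw0⟩ := W.exists_mem_ne_zero_of_ne_bot hne
    obtain ⟨i, hi⟩ : ∃ i, w i ≠ 0 := by
      by_contra! h
      exact hw0 (by ext i; exact h i)
    have hbi : periodicBasis σ x i ∈ W := by
      have h1 : periodicRep σ x z (Ell1.single 0 (indicatorMap {σ^[i] x})) w
          = w i • periodicBasis σ x i := by
        ext j
        rw [periodicRep_single_zero_apply]
        by_cases hj : j = i
        · subst hj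
          rw [indicatorMap_of_mem (Set.mem_singleton _)]
          simp
        · rw [indicatorMap_of_notMem (S := {σ^[(i : ℕ)] x}) (fun h => hj (Fin.ext
            (iterate_injOn_Iio_minimalPeriod (Set.mem_Iio.2 j.isLt) (Set.mem_Iio.2 i.isLt) h)))]
          simp [hj]
      have h2 := hW (Ell1.single 0 (indicatorMap {σ^[i] x})) w hw
      rw [periodicAlgRep_apply, h1] at h2
      exact (W.smul_mem_iff hi).1 h2
    have hsucc : ∀ j, periodicBasis σ x j ∈ W → periodicBasis σ x (cyclicSucc j) ∈ W :=
      fun j hj => by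
        have h2 := hW (Ell1.single 1 1) _ hj
        rw [periodicAlgRep_apply, periodicRep_single_one_basis] at h2
        refine (W.smul_mem_iff ?_).1 h2
        split_ifs
        · exact one_ne_zero
        · exact z.coe_ne_zero
    have hup : ∀ (j : Fin (minimalPeriod σ x)), periodicBasis σ x j ∈ W →
        ∀ d (h : j + d < minimalPeriod σ x), periodicBasis σ x ⟨j + d, h⟩ ∈ W := fun j hj d => by
      induction d with
      | zero => exact fun _ => hj
      | succ d ih =>
        intro h
        have h3 := hsucc _ (ih (by omega))
        rwa [cyclicSucc, dif_pos (by simp only; omega)] at h3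
    have hb0 : periodicBasis σ x ⟨0, hp⟩ ∈ W := by
      -- Climb from `e_i` to `e_{p-1}`; one more shift wraps around to `e_0`.
      have h3 := hup i hbi (minimalPeriod σ x - 1 - i) (by omega)
      have h4 := hsucc _ h3
      rwa [cyclicSucc, dif_neg (by simp only; omega)] at h4
    refine eq_top_iff.2 fun e _ => ?_
    rw [← sum_periodicBasis σ x e]
    refine W.sum_mem fun j _ => W.smul_mem _ ?_
    have h5 := hup _ hb0 j (by simp)
    simpa using h5

end PeriodicRep

/-! ### Orbits and periods -/

section Orbits

variable {X : Type u} [TopologicalSpace X] (σ : X ≃ₜ X)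

theorem zpow_apply_eq_toEquiv (n : ℤ) (x : X) :
    (σ ^ n : X ≃ₜ X) x = ((σ.toEquiv : Equiv.Perm X) ^ n) x := by
  let φ : (X ≃ₜ X) →* Equiv.Perm X :=
    { toFun := Homeomorph.toEquiv, map_one' := rfl, map_mul' := fun _ _ => rfl }
  exact congrArg (fun e : Equiv.Perm X => e x) (map_zpow φ σ n)

theorem zpow_natCast_apply (n : ℕ) (x : X) : (σ ^ (n : ℤ) : X ≃ₜ X) x = σ^[n] x := by
  rw [zpow_apply_eq_toEquiv, zpow_natCast, Equiv.Perm.coe_pow]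
  rfl

theorem zpow_minimalPeriod_apply (x : X) :
    (σ ^ (Function.minimalPeriod σ x : ℤ) : X ≃ₜ X) x = x := by
  rw [zpow_natCast_apply, Function.iterate_minimalPeriod]

theorem zpow_neg_minimalPeriod_apply (x : X) :
    (σ ^ (-(Function.minimalPeriod σ x : ℤ)) : X ≃ₜ X) x = x := by
  have h := (σ ^ (Function.minimalPeriod σ x : ℤ) : X ≃ₜ X).symm_apply_apply x
  rw [zpow_minimalPeriod_apply] at h
  rw [zpow_neg]
  exact h

/-- The orbit of `x`. -/
def orbitOf (x : X) : Set X := {y | Equiv.Perm.SameCycle σ.toEquiv x y}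

theorem self_mem_orbitOf (x : X) : x ∈ orbitOf σ x := Equiv.Perm.SameCycle.refl _ _

theorem zpow_apply_mem_orbitOf (x y : X) (n : ℤ) :
    (σ ^ n : X ≃ₜ X) y ∈ orbitOf σ x ↔ y ∈ orbitOf σ x := by
  rw [zpow_apply_eq_toEquiv]
  exact Equiv.Perm.sameCycle_zpow_right

/-- Powers of `σ` commute, so whatever power fixes `x` fixes its orbit pointwise. -/
theorem zpow_apply_of_mem_orbitOf {x y : X} {n : ℤ} (hn : (σ ^ n : X ≃ₜ X) x = x)
    (hy : y ∈ orbitOf σ x) : (σ ^ n : X ≃ₜ X) y = y := by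
  obtain ⟨i, rfl⟩ := hy
  rw [← zpow_apply_eq_toEquiv]
  change (σ ^ n * σ ^ i : X ≃ₜ X) x = _
  rw [← zpow_add, add_comm, zpow_add]
  exact congrArg _ hn

theorem exists_iterate_of_mem_orbitOf [Finite X] {x y : X} (hy : y ∈ orbitOf σ x) :
    ∃ i < Function.minimalPeriod σ x, σ^[i] x = y := by
  obtain ⟨n, hn⟩ := Equiv.Perm.SameCycle.exists_nat_pow_eq hy
  refine ⟨n % Function.minimalPeriod σ x, Nat.mod_lt _ (minimalPeriod_pos σ x), ?_⟩
  rw [Function.iterate_mod_minimalPeriod_eq, ← hn, Equiv.Perm.coe_pow]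
  rfl

theorem iterate_mem_orbitOf (x : X) (i : ℕ) : σ^[i] x ∈ orbitOf σ x := by
  rw [← zpow_natCast_apply, zpow_apply_mem_orbitOf]
  exact self_mem_orbitOf σ x

theorem minimalPeriod_eq_of_mem_orbitOf [Finite X] {x y : X} (hy : y ∈ orbitOf σ x) :
    Function.minimalPeriod σ y = Function.minimalPeriod σ x := by
  obtain ⟨i, _, rfl⟩ := exists_iterate_of_mem_orbitOf σ hy
  exact Function.minimalPeriod_apply_iterate (σ.injective.mem_periodicPts x) i

end Orbits

/-! ### Classification by orbit and circle parameter -/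

section Classification

variable {X : Type u} [TopologicalSpace X] [CompactSpace X] [DiscreteTopology X] {σ : X ≃ₜ X}

theorem alpha_indicatorMap_orbitOf (x : X) (n : ℤ) :
    alpha σ n (indicatorMap (orbitOf σ x)) = indicatorMap (orbitOf σ x) := by
  ext y
  rw [alpha_apply]
  by_cases hy : y ∈ orbitOf σ x
  · rw [indicatorMap_of_mem hy, indicatorMap_of_mem ((zpow_apply_mem_orbitOf σ x y _).2 hy)]
  · rw [indicatorMap_of_notMem hy,
      indicatorMap_of_notMem (mt (zpow_apply_mem_orbitOf σ x y _).1 hy)]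

theorem norm_indicatorMap_le (S : Set X) : ‖indicatorMap S‖ ≤ 1 := by
  rw [ContinuousMap.norm_le _ zero_le_one]
  intro x
  by_cases hx : x ∈ S
  · rw [indicatorMap_of_mem hx, norm_one]
  · rw [indicatorMap_of_notMem hx, norm_zero]
    exact zero_le_one

/-- Cutting down to the orbit is essential: `δ^n` alone need not be central, as `σ^n` may move
points outside the orbit. On the orbit `σ^{-n}` is the identity, so the twist disappears. -/
theorem single_indicatorMap_orbitOf_central {x : X} {n : ℤ} (hn : (σ ^ (-n) : X ≃ₜ X) x = x)
    (a : Ell1 σ) : Ell1.single n (indicatorMap (orbitOf σ x)) * a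
      = a * Ell1.single n (indicatorMap (orbitOf σ x)) := by
  refine Ell1.ext fun k => ?_
  rw [Ell1.single_mul_apply, Ell1.mul_single_apply, alpha_indicatorMap_orbitOf]
  ext y
  rw [ContinuousMap.mul_apply, ContinuousMap.mul_apply, alpha_apply]
  by_cases hy : y ∈ orbitOf σ x
  · rw [zpow_apply_of_mem_orbitOf σ hn hy, mul_comm]
  · rw [indicatorMap_of_notMem hy, zero_mul, mul_zero]

theorem mul_indicatorMap_singleton (f : C(X, ℂ)) (x : X) :
    f * indicatorMap {x} = f x • indicatorMap {x} := by
  ext y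
  rw [ContinuousMap.mul_apply, ContinuousMap.smul_apply, smul_eq_mul]
  by_cases hy : y = x
  · rw [hy]
  · rw [indicatorMap_of_notMem (S := {x}) hy, mul_zero, mul_zero]

section Irreducible

variable {E : Type*} [AddCommGroup E] [Module ℂ E] {π : Ell1 σ →ₙₐ[ℂ] Module.End ℂ E}

/-- Follows from `f · 1_{x} = f(x) 1_{x}`; it supplies the joint eigenvector of `C(X)`. -/
theorem map_single_zero_of_range {x : X} {v e : E}
    (hv : π (Ell1.single 0 (indicatorMap {x})) e = v) (f : C(X, ℂ)) :
    π (Ell1.single 0 f) v = f x • v := by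
  have h : (Ell1.single 0 (f x • indicatorMap {x}) : Ell1 σ)
      = f x • Ell1.single 0 (indicatorMap {x}) := Ell1.ext fun n => by
    rw [Ell1.smul_apply, Ell1.single_apply, Ell1.single_apply]
    split_ifs <;> simp
  rw [← hv, ← Module.End.mul_apply, ← map_mul, Ell1.single_mul_single_zero,
    mul_indicatorMap_singleton, h, map_smul, LinearMap.smul_apply]

/-- For a vector `v` in the range of `π(1_{x})`, the element `δ^p`, where `p` is the period of
`x`, acts on `v` as a scalar of modulus one. -/
theorem IsAlgIrreducible.exists_circle (hπ : IsAlgIrreducible π) {x : X} {v : E} (hv0 : v ≠ 0)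
    (hv : ∀ f, π (Ell1.single 0 f) v = f x • v) :
    ∃ z : Circle, π (Ell1.single (Function.minimalPeriod σ x) 1) v = (z : ℂ) • v := by
  set p : ℤ := (Function.minimalPeriod σ x : ℤ)
  set χ : C(X, ℂ) := indicatorMap (orbitOf σ x)
  have hχ : π (Ell1.single 0 χ) v = v := by
    rw [hv, indicatorMap_of_mem (self_mem_orbitOf σ x), one_smul]
  -- The central elements `χ δ^p` and `χ δ^{-p}` have norm at most 1 and product `χ`, which fixes
  -- `v`. Their scalars lie in the closed unit disc and multiply to 1, so both have modulus one.
  obtain ⟨μ, hμ, hμv⟩ := hπ.exists_scalar_of_central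
    (single_indicatorMap_orbitOf_central (σ := σ) (x := x) (n := p)
      (zpow_neg_minimalPeriod_apply σ x)) hv0
  obtain ⟨ν, hν, hνv⟩ := hπ.exists_scalar_of_central
    (single_indicatorMap_orbitOf_central (σ := σ) (x := x) (n := -p)
      (by rw [neg_neg]; exact zpow_minimalPeriod_apply σ x)) hv0
  rw [Ell1.norm_single] at hμ hν
  have hμ1 := hμ.trans (norm_indicatorMap_le _)
  have hν1 := hν.trans (norm_indicatorMap_le _)
  have hχχ : χ * χ = χ := by
    ext y
    rw [ContinuousMap.mul_apply]
    by_cases hy : y ∈ orbitOf σ x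
    · rw [indicatorMap_of_mem hy, mul_one]
    · rw [indicatorMap_of_notMem hy, mul_zero]
  have hprod : μ * ν = 1 := by
    have h1 : π (Ell1.single (-p) χ * Ell1.single p χ) v = v := by
      rw [Ell1.single_mul_single, alpha_indicatorMap_orbitOf, neg_add_cancel, hχχ, hχ]
    rw [map_mul, Module.End.mul_apply, hμv, map_smul, hνv, smul_smul] at h1
    exact smul_left_injective ℂ hv0 (h1.trans (one_smul ℂ v).symm)
  have hnorm : ‖μ‖ = 1 := by
    refine le_antisymm hμ1 ?_
    have h2 : ‖μ‖ * ‖ν‖ = 1 := by rw [← norm_mul, hprod, norm_one]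
    nlinarith [norm_nonneg μ]
  refine ⟨⟨μ, mem_sphere_zero_iff_norm.2 hnorm⟩, ?_⟩
  change _ = μ • v
  rw [← hμv]
  -- Inserting `χ`, which fixes `v`, turns `δ^p` into the central element `χ δ^p`.
  conv_lhs => rw [← hχ]
  rw [← Module.End.mul_apply, ← map_mul, Ell1.single_mul_single, alpha_indicatorMap_orbitOf,
    one_mul, add_zero]

/-- The linear map `e_j ↦ δ^j` from `H_{x,z}` to `ℓ¹(Σ)`. -/
def basisLift (σ : X ≃ₜ X) (x : X) : periodicSpace σ x →ₗ[ℂ] Ell1 σ where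
  toFun e := ∑ j : Fin (Function.minimalPeriod σ x), e j • Ell1.single (j : ℕ) 1
  map_add' e f := by
    simp only [PiLp.add_apply, add_smul, Finset.sum_add_distrib]
  map_smul' c e := by
    simp only [PiLp.smul_apply, smul_eq_mul, mul_smul, Finset.smul_sum, RingHom.id_apply]

theorem basisLift_periodicBasis (x : X) (j : Fin (Function.minimalPeriod σ x)) :
    basisLift σ x (periodicBasis σ x j) = Ell1.single (j : ℕ) 1 := by
  change ∑ i : Fin (Function.minimalPeriod σ x), (periodicBasis σ x j) i • _ = _
  rw [Finset.sum_eq_single j]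
  · simp
  · intro i _ hi
    simp [hi]
  · exact fun h => absurd (Finset.mem_univ j) h

/-- The linear map `e_j ↦ π(δ^j) v` from `H_{x,z}` to the space of `π`. -/
def orbitMap (π : Ell1 σ →ₙₐ[ℂ] Module.End ℂ E) (x : X) (v : E) : periodicSpace σ x →ₗ[ℂ] E where
  toFun e := π (basisLift σ x e) v
  map_add' e f := by rw [map_add, map_add, LinearMap.add_apply]
  map_smul' c e := by rw [map_smul, map_smul, LinearMap.smul_apply, RingHom.id_apply]

theorem orbitMap_periodicBasis (x : X) (v : E) (j : Fin (Function.minimalPeriod σ x)) :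
    orbitMap π x v (periodicBasis σ x j) = π (Ell1.single (j : ℕ) 1) v := by
  change π (basisLift σ x (periodicBasis σ x j)) v = _
  rw [basisLift_periodicBasis]

theorem linearMap_eq_of_periodicBasis {x : X} {S T : periodicSpace σ x →ₗ[ℂ] E}
    (h : ∀ j, S (periodicBasis σ x j) = T (periodicBasis σ x j)) : S = T := by
  ext e
  rw [← sum_periodicBasis σ x e, map_sum, map_sum]
  exact Finset.sum_congr rfl fun j _ => by rw [map_smul, map_smul, h]

/-- The point is `f δ^j = δ^j α^{-j}(f)`, together with `α^{-j}(f)(x) = f(σ^j x)`. -/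
theorem orbitMap_single_zero {x : X} {z : Circle} {v : E}
    (hv : ∀ f, π (Ell1.single 0 f) v = f x • v) (f : C(X, ℂ)) (e : periodicSpace σ x) :
    orbitMap π x v (periodicRep σ x z (Ell1.single 0 f) e)
      = π (Ell1.single 0 f) (orbitMap π x v e) := by
  refine LinearMap.congr_fun (f := orbitMap π x v ∘ₗ
    (periodicRep σ x z (Ell1.single 0 f) : periodicSpace σ x →ₗ[ℂ] periodicSpace σ x))
    (g := π (Ell1.single 0 f) ∘ₗ orbitMap π x v) (linearMap_eq_of_periodicBasis fun j => ?_) e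
  change orbitMap π x v (periodicRep σ x z (Ell1.single 0 f) (periodicBasis σ x j))
    = π (Ell1.single 0 f) (orbitMap π x v (periodicBasis σ x j))
  rw [periodicRep_single_zero_basis, map_smul, orbitMap_periodicBasis, ← Module.End.mul_apply,
    ← map_mul, Ell1.single_mul_single, alpha_zero, zero_add, mul_one]
  have h : (Ell1.single (j : ℕ) f : Ell1 σ)
      = Ell1.single (j : ℕ) 1 * Ell1.single 0 (alpha σ (-(j : ℕ)) f) := by
    rw [Ell1.single_mul_single, alpha_alpha, add_neg_cancel, alpha_zero, one_mul, add_zero]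
  rw [h, map_mul, Module.End.mul_apply, hv, map_smul, alpha_apply, neg_neg, zpow_natCast_apply]

/-- Only the wrap-around at `j = p - 1` needs an argument: there `δ^p v = z v` matches the corner
entry of `T_z`. -/
theorem IsAlgIrreducible.orbitMap_single_one (hπ : IsAlgIrreducible π) {x : X} {z : Circle}
    {v : E} (hz : π (Ell1.single (Function.minimalPeriod σ x) 1) v = (z : ℂ) • v)
    (e : periodicSpace σ x) :
    orbitMap π x v (periodicRep σ x z (Ell1.single 1 1) e)
      = π (Ell1.single 1 1) (orbitMap π x v e) := by
  refine LinearMap.congr_fun (f := orbitMap π x v ∘ₗ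
    (periodicRep σ x z (Ell1.single 1 1) : periodicSpace σ x →ₗ[ℂ] periodicSpace σ x))
    (g := π (Ell1.single 1 1) ∘ₗ orbitMap π x v) (linearMap_eq_of_periodicBasis fun j => ?_) e
  change orbitMap π x v (periodicRep σ x z (Ell1.single 1 1) (periodicBasis σ x j))
    = π (Ell1.single 1 1) (orbitMap π x v (periodicBasis σ x j))
  rw [periodicRep_single_one_basis, map_smul, orbitMap_periodicBasis, orbitMap_periodicBasis,
    ← Module.End.mul_apply, ← map_mul, Ell1.single_mul_single, map_one, one_mul]
  have h1 : (1 : ℤ) + (j : ℕ) = ((j + 1 : ℕ) : ℤ) := by push_cast; ring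
  rw [h1]
  by_cases hj : (j : ℕ) + 1 < Function.minimalPeriod σ x
  · rw [if_pos hj, one_smul, cyclicSucc, dif_pos hj]
  · rw [if_neg hj, cyclicSucc, dif_neg hj, show (j : ℕ) + 1 = Function.minimalPeriod σ x by omega,
      hz]
    change (z : ℂ) • π 1 v = _
    rw [hπ.apply_one, Module.End.one_apply]

/-- The elements satisfying the relation form a subalgebra. It is closed and contains `C(X)`, `δ`
and `δ⁻¹`, hence is everything. -/
theorem IsAlgIrreducible.orbitMap_intertwines (hπ : IsAlgIrreducible π) {x : X} {z : Circle}
    {v : E} (hv : ∀ f, π (Ell1.single 0 f) v = f x • v)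
    (hz : π (Ell1.single (Function.minimalPeriod σ x) 1) v = (z : ℂ) • v) (a : Ell1 σ)
    (e : periodicSpace σ x) :
    orbitMap π x v (periodicAlgRep σ x z a e) = π a (orbitMap π x v e) := by
  let S : Subalgebra ℂ (Ell1 σ) :=
    { carrier := {a | ∀ e, orbitMap π x v (periodicRep σ x z a e) = π a (orbitMap π x v e)}
      mul_mem' := fun {a b} ha hb e => by
        rw [map_mul, map_mul, mul_apply_eq_comp, Module.End.mul_apply, ha, hb]
      add_mem' := fun {a b} ha hb e => by
        rw [map_add, map_add, add_apply, map_add, LinearMap.add_apply, ha, hb]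
      algebraMap_mem' := fun c e => by
        rw [hπ.map_algebraMap, AlgHomClass.commutes, Algebra.algebraMap_eq_smul_one,
          smul_apply, one_apply_eq_self, map_smul] }
  have hclosed : IsClosed (S : Set (Ell1 σ)) := by
    -- `basisLift` expresses both sides as algebra elements applied to `v`, so each condition is the
    -- preimage of the closed annihilator under a continuous map.
    have hS : (S : Set (Ell1 σ)) = ⋂ e, (fun a => basisLift σ x (periodicRep σ x z a e)
        - a * basisLift σ x e) ⁻¹' {b | π b v = 0} := by
      ext a
      rw [Set.mem_iInter]
      refine forall_congr' fun e => ?_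
      change π (basisLift σ x (periodicRep σ x z a e)) v = π a (π (basisLift σ x e) v) ↔
        π (basisLift σ x (periodicRep σ x z a e) - a * basisLift σ x e) v = 0
      rw [map_sub, map_mul, LinearMap.sub_apply, Module.End.mul_apply, sub_eq_zero]
    rw [hS]
    refine isClosed_iInter fun e => (hπ.isClosed_annihilatorOf v).preimage ?_
    have h1 : Continuous (basisLift σ x) := LinearMap.continuous_of_finiteDimensional _
    have h2 : Continuous (periodicRep σ x z) := continuous_integratedForm _ _ _
    fun_prop
  refine Ell1.mem_of_isClosed S hclosed (fun f => orbitMap_single_zero hv f)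
    (hπ.orbitMap_single_one hz) (fun e => ?_) a e
  have h1 : (Ell1.single 1 1 * Ell1.single (-1) 1 : Ell1 σ) = 1 := by
    rw [Ell1.single_mul_single, map_one, mul_one]
    rfl
  have h2 : (Ell1.single (-1) 1 * Ell1.single 1 1 : Ell1 σ) = 1 := by
    rw [Ell1.single_mul_single, map_one, mul_one]
    rfl
  -- The relation for `δ⁻¹` follows from that for `δ`, applied to `δ⁻¹ e` and cancelled.
  have h3 := hπ.orbitMap_single_one hz (periodicRep σ x z (Ell1.single (-1) 1) e)
  rw [← mul_apply_eq_comp, ← map_mul, h1, map_one, one_apply_eq_self] at h3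
  rw [h3, ← Module.End.mul_apply, ← map_mul, h2, hπ.apply_one, Module.End.one_apply]

/-- An irreducible representation in which the characteristic function of `{x}` acts
nontrivially is equivalent to some `π_{x,z}`. -/
theorem IsAlgIrreducible.exists_algEquivalent [Finite X] (hπ : IsAlgIrreducible π) {x : X}
    (hx : π (Ell1.single 0 (indicatorMap {x})) ≠ 0) :
    ∃ z : Circle, AlgEquivalent (periodicAlgRep σ x z) π := by
  obtain ⟨e, he⟩ : ∃ e, π (Ell1.single 0 (indicatorMap {x})) e ≠ 0 := by
    by_contra! h
    exact hx (LinearMap.ext h)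
  have hv := map_single_zero_of_range (π := π) (x := x) (e := e) rfl
  obtain ⟨z, hz⟩ := hπ.exists_circle he hv
  refine ⟨z, algEquivalent_of_intertwining (isAlgIrreducible_periodicAlgRep σ x z) hπ
    (orbitMap π x _) (hπ.orbitMap_intertwines hv hz) fun h => he ?_⟩
  -- The map is nonzero because it sends `e_0` to the chosen eigenvector.
  have h0 := orbitMap_periodicBasis (π := π) x (π (Ell1.single 0 (indicatorMap {x})) e)
    ⟨0, minimalPeriod_pos σ x⟩
  rw [h, LinearMap.zero_apply] at h0
  change 0 = π 1 _ at h0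
  rw [hπ.apply_one] at h0
  exact h0.symm

/-- As `X` is finite, `1` is the sum of the characteristic functions of points; these cannot all act
as zero. -/
theorem IsAlgIrreducible.exists_single_ne_zero [Finite X] (hπ : IsAlgIrreducible π) :
    ∃ x : X, π (Ell1.single 0 (indicatorMap {x})) ≠ 0 := by
  by_contra! h
  have := Fintype.ofFinite X
  have h1 : (1 : Ell1 σ) = ∑ x : X, Ell1.single 0 (indicatorMap {x}) := by
    let φ : C(X, ℂ) →+ Ell1 σ :=
      { toFun := Ell1.single 0
        map_zero' := Ell1.ext fun n => by rw [Ell1.single_apply, ite_self, Ell1.zero_apply]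
        map_add' := fun f g => Ell1.ext fun n => by
          simp only [Ell1.add_apply, Ell1.single_apply]
          split_ifs <;> simp }
    have h2 : (1 : C(X, ℂ)) = ∑ x : X, indicatorMap {x} := by
      ext y
      rw [ContinuousMap.coe_sum, Finset.sum_apply, Finset.sum_eq_single y
        (fun x _ hxy => indicatorMap_of_notMem (S := {x}) (Ne.symm hxy))
        (fun h => absurd (Finset.mem_univ y) h), indicatorMap_of_mem (Set.mem_singleton y)]
      rfl
    exact (congrArg φ h2).trans (map_sum φ _ _)
  obtain ⟨a, e, hae⟩ := hπ.1
  refine hae ?_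
  rw [← one_mul a, map_mul, h1, map_sum, Finset.sum_eq_zero fun x _ => h x, zero_mul,
    LinearMap.zero_apply]

theorem IsAlgIrreducible.exists_periodic [Finite X] (hπ : IsAlgIrreducible π) :
    ∃ (x : X) (z : Circle), AlgEquivalent (periodicAlgRep σ x z) π := by
  obtain ⟨x, hx⟩ := hπ.exists_single_ne_zero
  exact ⟨x, hπ.exists_algEquivalent hx⟩

end Irreducible

/-- The operator is diagonal with entries `1_{x}(σ^j y)`. The kernel thus determines the orbit. -/
theorem periodicAlgRep_indicatorMap_ne_zero_iff [Finite X] (x y : X) (z : Circle) :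
    periodicAlgRep σ y z (Ell1.single 0 (indicatorMap {x})) ≠ 0 ↔
      Equiv.Perm.SameCycle σ.toEquiv x y := by
  constructor
  · contrapose!
    intro h
    refine linearMap_eq_of_periodicBasis fun j => ?_
    rw [periodicAlgRep_apply, periodicRep_single_zero_basis,
      indicatorMap_of_notMem (S := {x}) (fun hj => h ?_), zero_smul, LinearMap.zero_apply]
    rw [← Set.mem_singleton_iff.1 hj]
    exact (iterate_mem_orbitOf σ y j).symm
  · intro h h0
    obtain ⟨i, hi, hix⟩ := exists_iterate_of_mem_orbitOf σ (show x ∈ orbitOf σ y from h.symm)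
    have h1 := LinearMap.congr_fun h0 (periodicBasis σ y ⟨i, hi⟩)
    rw [periodicAlgRep_apply, periodicRep_single_zero_basis,
      indicatorMap_of_mem (S := {x}) hix, one_smul, LinearMap.zero_apply] at h1
    simpa using congrArg (fun e : periodicSpace σ y => e ⟨i, hi⟩) h1

theorem AlgEquivalent.symm {A : Type*} [Ring A] [Algebra ℂ A] {E F : Type*} [AddCommGroup E]
    [Module ℂ E] [AddCommGroup F] [Module ℂ F] {π : A →ₙₐ[ℂ] Module.End ℂ E}
    {ρ : A →ₙₐ[ℂ] Module.End ℂ F} (h : AlgEquivalent π ρ) : AlgEquivalent ρ π := by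
  obtain ⟨T, hT⟩ := h
  exact ⟨T.symm, fun a e => by
    rw [LinearEquiv.symm_apply_eq, hT, LinearEquiv.apply_symm_apply]⟩

theorem AlgEquivalent.trans {A : Type*} [Ring A] [Algebra ℂ A] {E F G : Type*} [AddCommGroup E]
    [Module ℂ E] [AddCommGroup F] [Module ℂ F] [AddCommGroup G] [Module ℂ G]
    {π : A →ₙₐ[ℂ] Module.End ℂ E} {ρ : A →ₙₐ[ℂ] Module.End ℂ F} {τ : A →ₙₐ[ℂ] Module.End ℂ G}
    (h : AlgEquivalent π ρ) (h' : AlgEquivalent ρ τ) : AlgEquivalent π τ := by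
  obtain ⟨T, hT⟩ := h
  obtain ⟨S, hS⟩ := h'
  exact ⟨T.trans S, fun a e => by
    rw [LinearEquiv.trans_apply, LinearEquiv.trans_apply, hT, hS]⟩

theorem AlgEquivalent.apply_eq_zero_iff {A : Type*} [Ring A] [Algebra ℂ A] {E F : Type*}
    [AddCommGroup E] [Module ℂ E] [AddCommGroup F] [Module ℂ F] {π : A →ₙₐ[ℂ] Module.End ℂ E}
    {ρ : A →ₙₐ[ℂ] Module.End ℂ F} (h : AlgEquivalent π ρ) (a : A) : π a = 0 ↔ ρ a = 0 := by
  obtain ⟨T, hT⟩ := h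
  constructor
  · intro ha
    ext f
    obtain ⟨e, rfl⟩ := T.surjective f
    rw [← hT, ha, LinearMap.zero_apply, map_zero, LinearMap.zero_apply]
  · intro ha
    ext e
    exact T.map_eq_zero_iff.1 ((hT a e).trans (by rw [ha, LinearMap.zero_apply]))

/-- Kernels separate orbits, and the scalar by which `δ^p` acts separates the circle parameters. For
points of one orbit no intertwiner is written down: the classification yields an equivalence with
some parameter `w`, and the forward direction identifies `w`. -/
theorem periodicAlgRep_algEquivalent_iff [Finite X] (x y : X) (z w : Circle) :
    AlgEquivalent (periodicAlgRep σ x z) (periodicAlgRep σ y w) ↔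
      Equiv.Perm.SameCycle σ.toEquiv x y ∧ z = w := by
  have hmp : ∀ {z w : Circle}, AlgEquivalent (periodicAlgRep σ x z) (periodicAlgRep σ y w) →
      Equiv.Perm.SameCycle σ.toEquiv x y ∧ z = w := fun {z w} h => by
    have hxy : Equiv.Perm.SameCycle σ.toEquiv x y := by
      rw [← periodicAlgRep_indicatorMap_ne_zero_iff x y w, Ne, ← h.apply_eq_zero_iff]
      exact (periodicAlgRep_indicatorMap_ne_zero_iff x x z).2 (Equiv.Perm.SameCycle.refl _ _)
    refine ⟨hxy, ?_⟩
    obtain ⟨T, hT⟩ := h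
    have hp := minimalPeriod_pos σ x
    have h1 := hT (Ell1.single (Function.minimalPeriod σ x) 1) (periodicBasis σ x ⟨0, hp⟩)
    have h3 := periodicRep_single_minimalPeriod σ y w (T (periodicBasis σ x ⟨0, hp⟩))
    -- Points of one orbit have equal periods, so the same power of `δ` is scalar on both sides.
    have h4 : (Ell1.single (Function.minimalPeriod σ y) 1 : Ell1 σ)
        = Ell1.single (Function.minimalPeriod σ x) 1 := by
      rw [minimalPeriod_eq_of_mem_orbitOf σ (x := x) hxy]
    rw [h4] at h3
    rw [periodicAlgRep_apply, periodicRep_single_minimalPeriod, map_smul, periodicAlgRep_apply,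
      h3] at h1
    refine Circle.ext (smul_left_injective ℂ (fun h0 => ?_) h1)
    have h2 := T.map_eq_zero_iff.1 h0
    simpa using congrArg (fun e : periodicSpace σ x => e ⟨0, hp⟩) h2
  refine ⟨hmp, ?_⟩
  rintro ⟨hxy, rfl⟩
  obtain ⟨w, hw⟩ := (isAlgIrreducible_periodicAlgRep σ y z).exists_algEquivalent
    ((periodicAlgRep_indicatorMap_ne_zero_iff x y z).2 hxy)
  obtain rfl := (hmp hw).2
  exact hw

end Classification

/-! ### Transport of Hilbert space structures -/

section StarRealizable

variable {A : Type*} [Ring A] [Algebra ℂ A] [StarRing A]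

/-- A representation that is equivalent to a `*`-representation on a finite dimensional Hilbert
space is itself a `*`-representation for a suitable inner product. -/
theorem isStarRealizable_of_linearEquiv {H : Type*} [NormedAddCommGroup H]
    [InnerProductSpace ℂ H] [FiniteDimensional ℂ H] [CompleteSpace H] {E : Type*}
    [AddCommGroup E] [Module ℂ E] {π : A →ₙₐ[ℂ] Module.End ℂ E} (ρ : A →⋆ₐ[ℂ] (H →L[ℂ] H))
    (T : H ≃ₗ[ℂ] E) (hT : ∀ a h, T (ρ a h) = π a (T h)) : IsStarRealizable π := by
  let c : InnerProductSpace.Core ℂ E :=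
    { inner := fun e f => inner ℂ (T.symm e) (T.symm f)
      conj_inner_symm := fun e f => inner_conj_symm _ _
      re_inner_nonneg := fun e => inner_self_nonneg
      add_left := fun e f g => by rw [map_add, inner_add_left]
      smul_left := fun e f r => by rw [map_smul, inner_smul_left]
      definite := fun e he => T.symm.map_eq_zero_iff.1 (inner_self_eq_zero.1 he) }
  refine ⟨c, ?_⟩
  let : NormedAddCommGroup E := c.toNormedAddCommGroup
  let : InnerProductSpace ℂ E := InnerProductSpace.ofCore c.toCore
  have hfin : FiniteDimensional ℂ E := T.finiteDimensional
  have hcomplete : CompleteSpace E := FiniteDimensional.complete ℂ E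
  -- For the transported inner product `T` is unitary, so conjugation by it preserves adjoints.
  let T' : H ≃ₗᵢ[ℂ] E := T.isometryOfInner fun x y => by
    change inner ℂ (T.symm (T x)) (T.symm (T y)) = _
    rw [T.symm_apply_apply, T.symm_apply_apply]
  refine ⟨hcomplete, ((T'.conjStarAlgEquiv : (H →L[ℂ] H) →⋆ₐ[ℂ] (E →L[ℂ] E)).comp
    ρ).toNonUnitalStarAlgHom, fun a e => ?_⟩
  change T (ρ a (T.symm e)) = π a e
  rw [hT, T.apply_symm_apply]

end StarRealizable

/-! ### The bijection with equivalence classes and its consequences -/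

section MainResult

variable {X : Type u} [TopologicalSpace X] [CompactSpace X] [DiscreteTopology X] [Finite X]

/-- The spaces `H_{x,z}` live in the lowest universe, whereas `IrrRep.{v}` asks for spaces in `Type
v`. -/
theorem algEquivalent_ulift {A : Type*} [Ring A] [Algebra ℂ A] {E : Type*} [AddCommGroup E]
    [Module ℂ E] (π : A →ₙₐ[ℂ] Module.End ℂ E) :
    ∃ ρ : A →ₙₐ[ℂ] Module.End ℂ (ULift.{v} E), AlgEquivalent π ρ := by
  let T : E ≃ₗ[ℂ] ULift.{v} E := ULift.moduleEquiv.symm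
  refine ⟨{ toFun := fun a => T.toLinearMap ∘ₗ π a ∘ₗ T.symm.toLinearMap
            map_smul' := fun c a => by ext e; simp
            map_zero' := by ext e; simp
            map_add' := fun a b => by ext e; simp
            map_mul' := fun a b => by ext e; simp }, T, fun a e => ?_⟩
  simp

theorem exists_irrRep_algEquivalent (σ : X ≃ₜ X) (x : X) (z : Circle) :
    ∃ π : IrrRep.{v} (Ell1 σ), AlgEquivalent (periodicAlgRep σ x z) π.π := by
  obtain ⟨ρ, hρ⟩ := algEquivalent_ulift.{v} (periodicAlgRep σ x z)
  exact ⟨⟨_, ρ, (isAlgIrreducible_periodicAlgRep σ x z).of_algEquivalent hρ⟩, hρ⟩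

/-- `π_{x,z}` as a representation on a space in a prescribed universe. -/
def periodicIrrRep (σ : X ≃ₜ X) (x : X) (z : Circle) : IrrRep.{v} (Ell1 σ) :=
  (exists_irrRep_algEquivalent σ x z).choose

theorem algEquivalent_periodicIrrRep (σ : X ≃ₜ X) (x : X) (z : Circle) :
    AlgEquivalent (periodicAlgRep σ x z) (periodicIrrRep.{u, v} σ x z).π :=
  (exists_irrRep_algEquivalent σ x z).choose_spec

theorem periodicIrrRep_equiv_iff (σ : X ≃ₜ X) (x : X) (z : Circle) (π : IrrRep.{v} (Ell1 σ)) :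
    (Quotient.mk _ (periodicIrrRep σ x z) : IrrRepClass (Ell1 σ)) = Quotient.mk _ π ↔
      AlgEquivalent (periodicAlgRep σ x z) π.π := by
  rw [Quotient.eq]
  exact ⟨fun h => (algEquivalent_periodicIrrRep σ x z).trans h,
    fun h => (algEquivalent_periodicIrrRep σ x z).symm.trans h⟩

/-- The map that sends an orbit and `z ∈ 𝕋` to the class of `π_{x,z}`, with `x` in the orbit. -/
def orbitClass (σ : X ≃ₜ X) (q : OrbitSpace σ × Circle) : IrrRepClass.{v} (Ell1 σ) :=
  Quotient.lift (fun x => (Quotient.mk _ (periodicIrrRep σ x q.2) : IrrRepClass.{v} (Ell1 σ)))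
    (fun x y hxy => (periodicIrrRep_equiv_iff σ x q.2 _).2
      (((periodicAlgRep_algEquivalent_iff x y q.2 q.2).2 ⟨hxy, rfl⟩).trans
        (algEquivalent_periodicIrrRep σ y q.2))) q.1

theorem orbitClass_eq_iff (σ : X ≃ₜ X) (x : X) (z : Circle) (π : IrrRep.{v} (Ell1 σ)) :
    orbitClass σ (Quotient.mk _ x, z) = Quotient.mk _ π ↔
      AlgEquivalent (periodicAlgRep σ x z) π.π :=
  periodicIrrRep_equiv_iff σ x z π

theorem bijective_orbitClass (σ : X ≃ₜ X) : Function.Bijective (orbitClass.{u, v} σ) := by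
  constructor
  · rintro ⟨q, z⟩ ⟨r, w⟩ h
    induction q using Quotient.inductionOn with | _ x
    induction r using Quotient.inductionOn with | _ y
    have h1 := (orbitClass_eq_iff σ x z _).1 h
    obtain ⟨hxy, rfl⟩ := (periodicAlgRep_algEquivalent_iff x y z w).1
      (h1.trans (algEquivalent_periodicIrrRep σ y w).symm)
    exact congrArg (fun q => (q, z)) (Quotient.sound hxy)
  · intro c
    induction c using Quotient.inductionOn with | _ π
    obtain ⟨x, z, h⟩ := π.irreducible.exists_periodic
    exact ⟨(Quotient.mk _ x, z), (orbitClass_eq_iff σ x z π).2 h⟩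

theorem IrrRep.finiteDimensional {σ : X ≃ₜ X} (π : IrrRep.{v} (Ell1 σ)) :
    FiniteDimensional ℂ π.E := by
  obtain ⟨x, z, T, _⟩ := π.irreducible.exists_periodic
  exact T.finiteDimensional

theorem IrrRep.isStarRealizable {σ : X ≃ₜ X} (π : IrrRep.{v} (Ell1 σ)) :
    IsStarRealizable π.π := by
  obtain ⟨x, z, T, hT⟩ := π.irreducible.exists_periodic
  exact isStarRealizable_of_linearEquiv (periodicRep σ x z) T hT

/-- Equivalent representations have equal kernels, so the ideal is the kernel of a `*`-homomorphism.
-/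
theorem IsPrimitiveIdeal.star_mem {σ : X ≃ₜ X} {I : TwoSidedIdeal (Ell1 σ)}
    (hI : IsPrimitiveIdeal.{v} I) {a : Ell1 σ} (ha : a ∈ I) : star a ∈ I := by
  obtain ⟨π, hπ⟩ := hI
  obtain ⟨x, z, h⟩ := π.irreducible.exists_periodic
  have hker : ∀ b, b ∈ I ↔ periodicRep σ x z b = 0 := fun b => by
    rw [hπ, ← h.apply_eq_zero_iff]
    exact ⟨fun hb => ContinuousLinearMap.coe_injective hb,
      fun hb => congrArg ContinuousLinearMap.toLinearMap hb⟩
  rw [hker] at ha ⊢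
  rw [map_star, ha]
  exact star_zero (periodicSpace σ x →L[ℂ] periodicSpace σ x)

end MainResult

end DynSys

end

theorem mainTheorem11 {X : Type u} [TopologicalSpace X] [CompactSpace X] [T2Space X] [Nonempty X]
    [Finite X] (σ : X ≃ₜ X) :
    (∀ π : DynSys.IrrRep.{v} (DynSys.Ell1 σ), FiniteDimensional ℂ π.E) ∧
    (∀ (x : X) (z : Circle), DynSys.IsAlgIrreducible (DynSys.periodicAlgRep σ x z)) ∧
    (∃ Ξ : DynSys.OrbitSpace σ × Circle → DynSys.IrrRepClass.{v} (DynSys.Ell1 σ),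
      Function.Bijective Ξ ∧
      ∀ (x : X) (z : Circle) (π : DynSys.IrrRep.{v} (DynSys.Ell1 σ)),
        Ξ (Quotient.mk _ x, z) = Quotient.mk _ π ↔
          DynSys.AlgEquivalent (DynSys.periodicAlgRep σ x z) π.π) ∧
    (∀ π : DynSys.IrrRep.{v} (DynSys.Ell1 σ), DynSys.IsStarRealizable π.π) ∧
    (∀ I : TwoSidedIdeal (DynSys.Ell1 σ), DynSys.IsPrimitiveIdeal.{v} I →
      ∀ a ∈ I, star a ∈ I) :=
  -- Finite and Hausdorff imply discrete, which provides the `DiscreteTopology` instance required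
  -- here.
  ⟨fun π => π.finiteDimensional, DynSys.isAlgIrreducible_periodicAlgRep σ,
    ⟨DynSys.orbitClass σ, DynSys.bijective_orbitClass σ, DynSys.orbitClass_eq_iff σ⟩,
    fun π => π.isStarRealizable, fun _ hI _ ha => hI.star_mem ha⟩
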